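/- **Theorem (stability of multiplicative representations under change of generators).** Let $\Gamma$ be a finitely generated free group. A *symmetric set of free generators* of $\Gamma$ is a set $A=S\cup S^{-1}$ with $S$ a (finite) free basis of $\Gamma$; we write $\mathbb F_A$ for $\Gamma$ with this choice, and $|x|$ for the length of the reduced word of $x\in\Gamma$ in the alphabet $A$. A *matrix system with inner products* $(V_a,H_{ba},B_a)$ indexed by $A$ consists of finite-dimensional complex vector spaces $V_a$ ($a\in A$), linear maps $H_{ba}:V_a\to V_b$ ($a,b\in A$) with $H_{ba}=0$ whenever $ab=e$, and positive definite sesquilinear forms $B_a$ on $V_a$ such that $B_a(v,v)=\sum_{b\in A}B_b(H_{ba}v,H_{ba}v)$ for all $a\in A$, $v\in V_a$. A *multiplicative function* is a map $f:\Gamma\to\coprod_{a\in A} V_a$ for which there is $N\ge 0$ such that, whenever $|x|\ge N$ and the reduced word of $x$ ends with $a$, one has $f(x)\in V_a$ and $f(xb)=H_{ba}f(x)$ for all $b\in A$ with $|xb|=|x|+1$. Let $\mathcal H^\infty=\mathcal H^\infty(V_a,H_{ba},B_a)$ be the vector space of multiplicative functions modulo equality outside finite sets, with the inner product $$\langle f_1,f_2\rangle=\sum_{|x|=N}\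 \sum_{a\in A,\ |xa|=|x|+1}B_a\big(f_1(xa),f_2(xa)\big)\qquad (N\text{ large enough; the value does not depend on }N),$$ let $\mathcal H$ be its completion, and let $(\pi(x)f)(y)=f(x^{-1}y)$ on $\mathcal H^\infty$. A unitary representation $(\rho,H)$ of $\Gamma$ on a complex Hilbert space belongs to $\mathbf{Mult}(\mathbb F_A)$ if there are a matrix system with inner products indexed by $A$, a dense subspace $M\subseteq H$, and a unitary operator $U:H\to\mathcal H$ with $U(M)=\mathcal H^\infty$ and $U\rho(x)m=\pi(x)Um$ for all $m\in M$, $x\in\Gamma$. It belongs to $\mathbf{Mult}(\Gamma)$ if it belongs to $\mathbf{Mult}(\mathbb F_A)$ for some symmetric set $A$ of free generators of $\Gamma$. Let $A$ and $A'$ be two symmetric sets of free generators of $\Gamma$, and let $(\rho,H)$ be a unitary representation of $\Gamma$. 1. If $\rho\in\mathbf{Mult}(\mathbb F_{A'})$, then there is a matrix system with inner products indexed by $A$ through which $\rho\in\mathbf{Mult}(\mathbb F_A)$. 2. In particular these classes are $\mathrm{Aut}(\Gamma)$-invariant: for every $\varphi\in\mathrm{Aut}(\Gamma)$, if $\rho\in\mathbf{Mult}(\mathbb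 F_A)$ then $\rho\circ\varphi\in\mathbf{Mult}(\mathbb F_A)$, and if $\rho\in\mathbf{Mult}(\Gamma)$ then $\rho\circ\varphi\in\mathbf{Mult}(\Gamma)$. -/

import Mathlib

namespace FreeMult

universe u v w

/-- The alphabet of a free basis indexed by `ι`: the letter `(i, true)` stands for the `i`-th
generator and `(i, false)` for its inverse. Through `letter` below it is the symmetric set `A` of
free generators `A = {b i} ∪ {(b i)⁻¹}`. -/
abbrev Letter (ι : Type v) : Type v := ι × Bool

/-- The inverse letter. -/
def Letter.inv {ι : Type v} (a : Letter ι) : Letter ι := (a.1, !a.2)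

section Words

variable {Γ : Type u} [Group Γ] {ι : Type v}

/-- The element of the symmetric generating set `A` that corresponds to a letter. -/
def letter (b : FreeGroupBasis ι Γ) (a : Letter ι) : Γ :=
  if a.2 then b a.1 else (b a.1)⁻¹

theorem repr_letter (b : FreeGroupBasis ι Γ) (a : Letter ι) : b.repr (letter b a) = FreeGroup.mk [a] := by
  obtain ⟨i, s⟩ := a
  cases s <;> simp [letter, FreeGroup.of, FreeGroup.inv_mk, FreeGroup.invRev]

variable [DecidableEq ι]

/-- The reduced word of `x` in the alphabet of the basis `b`. -/
def word (b : FreeGroupBasis ι Γ) (x : Γ) : List (Letter ι) := (b.repr x).toWord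

/-- The word length `|x|` of `x` in the alphabet of the basis `b`. -/
def len (b : FreeGroupBasis ι Γ) (x : Γ) : ℕ := (word b x).length

/-- `EndsWith b x a` says that `x ∈ E(a)`: the reduced word of `x` ends with the letter `a`. -/
def EndsWith (b : FreeGroupBasis ι Γ) (x : Γ) (a : Letter ι) : Prop :=
  (word b x).getLast? = some a

variable (b : FreeGroupBasis ι Γ)

theorem word_injective : Function.Injective (word b) :=
  FreeGroup.toWord_injective.comp b.repr.injective

theorem word_mul_letter (x : Γ) (a : Letter ι) :
    word b (x * letter b a) = FreeGroup.reduce (word b x ++ [a]) := by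
  simp [word, repr_letter, FreeGroup.toWord_mul]

theorem word_letter_mul (x : Γ) (a : Letter ι) :
    word b (letter b a * x) = FreeGroup.reduce (a :: word b x) := by
  simp only [word, map_mul, repr_letter, FreeGroup.toWord_mul, FreeGroup.toWord_mk]
  rw [← FreeGroup.reduce_append_reduce_reduce]
  simp

theorem isReduced_word (x : Γ) : FreeGroup.IsReduced (word b x) := FreeGroup.isReduced_toWord

theorem word_mul_letter_of_ne {x : Γ} {a : Letter ι} (h : ¬ EndsWith b x a.inv) :
    word b (x * letter b a) = word b x ++ [a] := by
  rw [word_mul_letter, FreeGroup.IsReduced.reduce_eq]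
  have hx := isReduced_word b x
  unfold FreeGroup.IsReduced at *
  rw [List.isChain_append]
  refine ⟨hx, by simp, ?_⟩
  intro c hc d hd h1
  simp only [List.head?_cons, Option.mem_def, Option.some.injEq] at hd
  subst hd
  by_contra h2
  apply h
  have : c = a.inv := by
    ext
    · exact h1
    · simp only [Letter.inv]
      revert h2
      cases c.2 <;> cases a.2 <;> simp
  rw [EndsWith, ← this]
  exact hc

theorem word_mul_letter_of_endsWith {x : Γ} {a : Letter ι} (h : EndsWith b x a.inv) :
    word b x = word b (x * letter b a) ++ [a.inv] := by
  obtain ⟨l, hl⟩ := List.getLast?_eq_some_iff.mp h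
  rw [word_mul_letter, hl]
  have hr := isReduced_word b x
  rw [hl] at hr
  have h1 : FreeGroup.reduce ((l ++ [a.inv]) ++ [a]) = FreeGroup.reduce l := by
    apply FreeGroup.reduce.sound
    rw [List.append_assoc]
    apply Quot.sound
    have := FreeGroup.Red.Step.not (L₁ := l) (L₂ := []) (x := a.1) (b := !a.2)
    simpa [Letter.inv] using this
  rw [h1, FreeGroup.IsReduced.reduce_eq (hr.infix (List.infix_append' [] l _))]

theorem len_mul_letter_iff (x : Γ) (a : Letter ι) :
    len b (x * letter b a) = len b x + 1 ↔ ¬ EndsWith b x a.inv := by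
  constructor
  · intro h h'
    have := congrArg List.length (word_mul_letter_of_endsWith b h')
    simp only [len, List.length_append, List.length_singleton] at *
    omega
  · intro h
    simp [len, word_mul_letter_of_ne b h]

theorem endsWith_mul_letter {x : Γ} {a : Letter ι} (h : len b (x * letter b a) = len b x + 1) :
    EndsWith b (x * letter b a) a := by
  rw [len_mul_letter_iff] at h
  simp [EndsWith, word_mul_letter_of_ne b h]

theorem letter_mul_aux {y : Γ} (hy : 2 ≤ len b y) (a : Letter ι) :
    (word b (letter b a * y)).getLast? = (word b y).getLast? ∧
      len b y ≤ len b (letter b a * y) + 1 := by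
  rw [len, len, word_letter_mul, FreeGroup.reduce.cons]
  have hred : FreeGroup.reduce (word b y) = word b y := (isReduced_word b y).reduce_eq
  rw [hred]
  rw [len] at hy
  match hw : word b y, hy with
  | c :: d :: l, _ =>
    simp only
    split_ifs <;> simp

theorem finite_len_le [Finite ι] (N : ℕ) : {x : Γ | len b x ≤ N}.Finite :=
  (List.finite_length_le (Letter ι) N).preimage (word_injective b).injOn

/-- The sphere `{x : |x| = N}`, as a finite set. -/
noncomputable def sphere [Finite ι] (N : ℕ) : Finset Γ :=
  ((finite_len_le b N).subset (fun _ h => le_of_eq h) : {x : Γ | len b x = N}.Finite).toFinset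

theorem mem_sphere [Finite ι] {N : ℕ} {x : Γ} : x ∈ sphere b N ↔ len b x = N := by
  simp [sphere]

theorem sum_sphere_succ [Fintype ι] (N : ℕ) (F : Γ → ℂ) :
    ∑ y ∈ sphere b (N + 1), F y =
      ∑ x ∈ sphere b N, ∑ a : Letter ι,
        if len b (x * letter b a) = len b x + 1 then F (x * letter b a) else 0 := by
  symm
  simp_rw [← Finset.sum_filter]
  rw [Finset.sum_sigma']
  refine Finset.sum_bij (fun p _ => p.1 * letter b p.2) ?_ ?_ ?_ ?_
  · rintro ⟨x, a⟩ h
    simp only [Finset.mem_sigma, mem_sphere, Finset.mem_filter, Finset.mem_univ, true_and] at h ⊢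
    omega
  · rintro ⟨x, a⟩ h ⟨y, c⟩ h' heq
    simp only [Finset.mem_sigma, mem_sphere, Finset.mem_filter, Finset.mem_univ, true_and] at *
    have h1 := (len_mul_letter_iff b x a).mp h.2
    have h2 := (len_mul_letter_iff b y c).mp h'.2
    have h3 := congrArg (word b) heq
    rw [word_mul_letter_of_ne b h1, word_mul_letter_of_ne b h2] at h3
    have h4 := List.append_inj' h3 rfl
    obtain rfl := word_injective b h4.1
    simp at h4
    rw [h4]
  · intro y hy
    rw [mem_sphere] at hy
    have hne : word b y ≠ [] := by
      intro h
      simp [len, h] at hy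
    obtain ⟨l, a, hl⟩ := (List.eq_nil_or_concat (word b y)).resolve_left hne
    rw [List.concat_eq_append] at hl
    have hE : EndsWith b y (Letter.inv a.inv) := by simp [EndsWith, hl, Letter.inv]
    have h1 := congrArg List.length (word_mul_letter_of_endsWith b hE)
    simp only [List.length_append, List.length_singleton] at h1
    have hinv : letter b a.inv * letter b a = 1 := by
      obtain ⟨i, s⟩ := a
      cases s <;> simp [letter, Letter.inv]
    simp only [len] at hy
    refine ⟨⟨y * letter b a.inv, a⟩, ?_, ?_⟩
    · simp only [Finset.mem_sigma, mem_sphere, Finset.mem_filter, Finset.mem_univ, true_and,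
        mul_assoc, hinv, mul_one, len]
      omega
    · simp [mul_assoc, hinv]
  · intros
    rfl

end Words

/-- A matrix system with inner products `(V_a, H_{ba}, B_a)` indexed by the letters of a finite
alphabet: finite-dimensional complex vector spaces `V a`, linear maps `H b a : V a → V b` that
vanish when `b = a⁻¹`, and positive definite sesquilinear forms `B a` (conjugate-linear in the
first variable) that satisfy the compatibility condition. -/
structure InnerSystem (ι : Type v) [Fintype ι] where
  V : Letter ι → Type
  [addCommGroup : ∀ a, AddCommGroup (V a)]
  [module : ∀ a, Module ℂ (V a)]
  [finiteDimensional : ∀ a, FiniteDimensional ℂ (V a)]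
  H : ∀ b a, V a →ₗ[ℂ] V b
  H_inv : ∀ a, H a.inv a = 0
  B : ∀ a, V a →ₗ⋆[ℂ] V a →ₗ[ℂ] ℂ
  B_symm : ∀ a v w, (starRingEnd ℂ) (B a w v) = B a v w
  B_pos : ∀ a v, v ≠ 0 → 0 < (B a v v).re
  compat : ∀ a v, B a v v = ∑ b, B b (H b a v) (H b a v)

attribute [instance] InnerSystem.addCommGroup InnerSystem.module InnerSystem.finiteDimensional

namespace InnerSystem

theorem compat_polar {ι : Type v} [Fintype ι] (S : InnerSystem ι) (a : Letter ι) (v w : S.V a) :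
    S.B a v w = ∑ b, S.B b (S.H b a v) (S.H b a w) := by
  have h0 := S.compat a v
  have h1 := S.compat a w
  have h2 := S.compat a (v + w)
  have h3 := S.compat a (v + Complex.I • w)
  simp only [map_add, LinearMap.add_apply, map_smul, LinearMap.map_smulₛₗ, LinearMap.smul_apply,
    Finset.sum_add_distrib, smul_eq_mul, ← Finset.mul_sum, Complex.conj_I]
    at h2 h3
  rw [← h0, ← h1] at h2 h3
  linear_combination (1 / 2) * h2 - (Complex.I / 2) * h3 +
    (1 / 2) * (S.B a v w - ∑ b, S.B b (S.H b a v) (S.H b a w) - S.B a w v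
      + ∑ b, S.B b (S.H b a w) (S.H b a v)) * Complex.I_sq

theorem B_self_nonneg {ι : Type v} [Fintype ι] (S : InnerSystem ι) (a : Letter ι) (v : S.V a) : 0 ≤ (S.B a v v).re := by
  by_cases h : v = 0
  · simp [h]
  · exact (S.B_pos a v h).le

variable {Γ : Type u} [Group Γ] {ι : Type v} [Fintype ι] [DecidableEq ι]
variable (S : InnerSystem ι) (b : FreeGroupBasis ι Γ)

/-- `f` is multiplicative for `|x| ≥ N`. The disjoint union of the spaces `V a` is embedded in
their product: `f x ∈ V_a` means that all components of `f x` other than the one at `a` vanish. -/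
def IsMultFrom (N : ℕ) (f : Γ → ∀ a, S.V a) : Prop :=
  ∀ x, N ≤ len b x → ∀ a, EndsWith b x a →
    (∀ c, c ≠ a → f x c = 0) ∧
    ∀ c, len b (x * letter b c) = len b x + 1 →
      f (x * letter b c) = Pi.single c (S.H c a (f x a))

theorem IsMultFrom.mono {S : InnerSystem ι} {b : FreeGroupBasis ι Γ} {N M : ℕ}
    {f : Γ → ∀ a, S.V a} (h : S.IsMultFrom b N f) (hNM : N ≤ M) : S.IsMultFrom b M f :=
  fun x hx => h x (hNM.trans hx)

/-- The space of multiplicative functions (functions multiplicative for `|x| ≥ N`, some `N`). -/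
def mult : Submodule ℂ (Γ → ∀ a, S.V a) where
  carrier := {f | ∃ N, S.IsMultFrom b N f}
  zero_mem' := ⟨0, fun x _ a _ => ⟨fun _ _ => rfl, fun c _ => by simp⟩⟩
  add_mem' := by
    rintro f g ⟨N, hf⟩ ⟨M, hg⟩
    refine ⟨max N M, fun x hx a ha => ?_⟩
    have h1 := hf.mono (le_max_left N M) x hx a ha
    have h2 := hg.mono (le_max_right N M) x hx a ha
    refine ⟨fun c hc => ?_, fun c hc => ?_⟩
    · simp [h1.1 c hc, h2.1 c hc]
    · simp [h1.2 c hc, h2.2 c hc, Pi.single_add]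
  smul_mem' := by
    rintro r f ⟨N, hf⟩
    refine ⟨N, fun x hx a ha => ?_⟩
    have h1 := hf x hx a ha
    refine ⟨fun c hc => ?_, fun c hc => ?_⟩
    · simp [h1.1 c hc]
    · simp [h1.2 c hc, Pi.single_smul]

/-- The multiplicative functions that vanish at all but finitely many group elements. -/
def null : Submodule ℂ (S.mult b) where
  carrier := {f | {x | f.1 x ≠ 0}.Finite}
  zero_mem' := by simp
  add_mem' := by
    intro f g hf hg
    refine (Set.Finite.union hf hg).subset fun x hx => ?_
    by_contra h
    simp only [Set.mem_union, Set.mem_ofPred_eq, not_or, not_not] at h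
    apply hx
    simp [h.1, h.2]
  smul_mem' := by
    intro r f hf
    refine Set.Finite.subset hf fun x hx h => hx ?_
    simp [h]

/-- The space `ℋ^∞` of multiplicative functions modulo equality up to finitely many values. -/
def Hinf : Type (max u v) := S.mult b ⧸ S.null b

noncomputable instance : AddCommGroup (S.Hinf b) :=
  inferInstanceAs (AddCommGroup (S.mult b ⧸ S.null b))

noncomputable instance : Module ℂ (S.Hinf b) :=
  inferInstanceAs (Module ℂ (S.mult b ⧸ S.null b))

/-- The class in `ℋ^∞` of a multiplicative function. -/
def cls : S.mult b →ₗ[ℂ] S.Hinf b := (S.null b).mkQ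

/-- `∑_{|x| = N} ∑_{a, |xa| = |x| + 1} B_a(f(xa), g(xa))`. -/
noncomputable def sphereForm (N : ℕ) (f g : Γ → ∀ a, S.V a) : ℂ :=
  ∑ x ∈ sphere b N, ∑ a : Letter ι,
    if len b (x * letter b a) = len b x + 1 then
      S.B a (f (x * letter b a) a) (g (x * letter b a) a)
    else 0

theorem sphereForm_succ {S : InnerSystem ι} {b : FreeGroupBasis ι Γ} {N : ℕ}
    {f g : Γ → ∀ a, S.V a} (hf : S.IsMultFrom b N f) (hg : S.IsMultFrom b N g) :
    S.sphereForm b (N + 1) f g = S.sphereForm b N f g := by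
  have key : S.sphereForm b N f g
      = ∑ y ∈ sphere b (N + 1), ∑ c : Letter ι, S.B c (f y c) (g y c) := by
    rw [sum_sphere_succ, sphereForm]
    refine Finset.sum_congr rfl fun x hx => Finset.sum_congr rfl fun a _ => ?_
    rw [mem_sphere] at hx
    split_ifs with h
    · rw [Finset.sum_eq_single a]
      · intro c _ hc
        rw [(hf _ (by omega) a (endsWith_mul_letter b h)).1 c hc]
        simp
      · simp
    · rfl
  rw [key, sphereForm]
  refine Finset.sum_congr rfl fun x hx => ?_
  rw [mem_sphere] at hx
  obtain ⟨a, ha⟩ : ∃ a, EndsWith b x a := by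
    have hne : word b x ≠ [] := by
      intro h
      simp [len, h] at hx
    exact ⟨_, List.getLast?_eq_some_getLast hne⟩
  have h1 := hf x (by omega) a ha
  have h2 := hg x (by omega) a ha
  have hR : ∑ c : Letter ι, S.B c (f x c) (g x c) = S.B a (f x a) (g x a) :=
    Finset.sum_eq_single a (fun c _ hc => by rw [h1.1 c hc]; simp) (by simp)
  rw [hR, S.compat_polar]
  refine Finset.sum_congr rfl fun c _ => ?_
  split_ifs with h
  · rw [h1.2 c h, h2.2 c h]
    simp
  · rw [len_mul_letter_iff, not_not] at h
    have hca : c = a.inv := by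
      have : some a = some c.inv := ha.symm.trans h
      simp only [Option.some.injEq] at this
      simp [this, Letter.inv]
    subst hca
    simp [S.H_inv]

theorem sphereForm_eq {S : InnerSystem ι} {b : FreeGroupBasis ι Γ} {N M : ℕ}
    {f g : Γ → ∀ a, S.V a} (hf : S.IsMultFrom b N f) (hg : S.IsMultFrom b N g) (hNM : N ≤ M) :
    S.sphereForm b M f g = S.sphereForm b N f g := by
  induction M, hNM using Nat.le_induction with
  | base => rfl
  | succ M hM ih => rw [sphereForm_succ (hf.mono hM) (hg.mono hM), ih]

/-- The sesquilinear form on multiplicative functions: `sphereForm` for a large `N`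
(see `form_eq`: the value is the same for all `N` from which both functions are multiplicative). -/
noncomputable def form (f g : S.mult b) : ℂ :=
  S.sphereForm b (max f.2.choose g.2.choose) f.1 g.1

theorem form_eq {S : InnerSystem ι} {b : FreeGroupBasis ι Γ} {N : ℕ} {f g : S.mult b}
    (hf : S.IsMultFrom b N f.1) (hg : S.IsMultFrom b N g.1) :
    S.form b f g = S.sphereForm b N f.1 g.1 := by
  set K := max f.2.choose g.2.choose with hK
  have h1 : S.IsMultFrom b K f.1 := f.2.choose_spec.mono (le_max_left _ _)
  have h2 : S.IsMultFrom b K g.1 := g.2.choose_spec.mono (le_max_right _ _)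
  rw [form, ← hK, ← sphereForm_eq h1 h2 (le_max_left K N), sphereForm_eq hf hg (le_max_right K N)]

theorem form_eventually (f g : S.mult b) :
    ∃ N, ∀ M, N ≤ M → S.form b f g = S.sphereForm b M f.1 g.1 := by
  obtain ⟨N, hN⟩ := f.2
  obtain ⟨K, hK⟩ := g.2
  exact ⟨max N K, fun M hM => form_eq (hN.mono ((le_max_left _ _).trans hM))
    (hK.mono ((le_max_right _ _).trans hM))⟩

theorem eq_of_sub_mem_null {f f' : S.mult b} (h : f - f' ∈ S.null b) :
    ∃ N, ∀ x, N < len b x → f.1 x = f'.1 x := by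
  have hfin : {x | (f - f').1 x ≠ 0}.Finite := h
  obtain ⟨N, hN⟩ := (hfin.image (len b)).bddAbove
  refine ⟨N, fun x hx => ?_⟩
  by_contra hne
  have : len b x ≤ N := hN ⟨x, by
    intro h0
    apply hne
    simpa [sub_eq_zero] using h0, rfl⟩
  omega

theorem form_congr {f f' g g' : S.mult b} (hf : f - f' ∈ S.null b) (hg : g - g' ∈ S.null b) :
    S.form b f g = S.form b f' g' := by
  obtain ⟨N1, h1⟩ := S.form_eventually b f g
  obtain ⟨N2, h2⟩ := S.form_eventually b f' g'
  obtain ⟨N3, h3⟩ := S.eq_of_sub_mem_null b hf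
  obtain ⟨N4, h4⟩ := S.eq_of_sub_mem_null b hg
  set M := N1 + N2 + N3 + N4
  rw [h1 M (by omega), h2 M (by omega), sphereForm, sphereForm]
  refine Finset.sum_congr rfl fun x hx => Finset.sum_congr rfl fun a _ => ?_
  rw [mem_sphere] at hx
  split_ifs with h
  · rw [h3 _ (by omega), h4 _ (by omega)]
  · rfl

theorem cls_eq_cls {f g : S.mult b} : S.cls b f = S.cls b g ↔ f - g ∈ S.null b :=
  Submodule.Quotient.eq (S.null b)

theorem cls_surjective : Function.Surjective (S.cls b) := Submodule.Quotient.mk_surjective (S.null b)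

/-- The inner product on `ℋ^∞`, computed on arbitrary representatives (see `formInf_cls`). -/
noncomputable def formInf (p q : S.Hinf b) : ℂ :=
  S.form b (S.cls_surjective b p).choose (S.cls_surjective b q).choose

theorem formInf_cls (f g : S.mult b) : S.formInf b (S.cls b f) (S.cls b g) = S.form b f g :=
  S.form_congr b ((S.cls_eq_cls b).mp (S.cls_surjective b _).choose_spec)
    ((S.cls_eq_cls b).mp (S.cls_surjective b _).choose_spec)

/-- The inner product makes `ℋ^∞` a pre-Hilbert space. -/
@[reducible] noncomputable def core : InnerProductSpace.Core ℂ (S.Hinf b) where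
  inner := S.formInf b
  conj_inner_symm p q := by
    obtain ⟨f, rfl⟩ := S.cls_surjective b p
    obtain ⟨g, rfl⟩ := S.cls_surjective b q
    rw [formInf_cls, formInf_cls]
    obtain ⟨N, hN⟩ := S.form_eventually b f g
    obtain ⟨M, hM⟩ := S.form_eventually b g f
    rw [hN (max N M) (le_max_left _ _), hM (max N M) (le_max_right _ _), sphereForm, sphereForm,
      map_sum]
    refine Finset.sum_congr rfl fun x _ => ?_
    rw [map_sum]
    refine Finset.sum_congr rfl fun a _ => ?_
    split_ifs
    · exact S.B_symm a _ _
    · simp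
  re_inner_nonneg p := by
    obtain ⟨f, rfl⟩ := S.cls_surjective b p
    rw [formInf_cls]
    obtain ⟨N, hN⟩ := S.form_eventually b f f
    rw [hN N le_rfl, sphereForm, map_sum]
    refine Finset.sum_nonneg fun x _ => ?_
    rw [map_sum]
    refine Finset.sum_nonneg fun a _ => ?_
    split_ifs
    · exact S.B_self_nonneg a _
    · simp
  add_left p q r := by
    obtain ⟨f, rfl⟩ := S.cls_surjective b p
    obtain ⟨g, rfl⟩ := S.cls_surjective b q
    obtain ⟨h, rfl⟩ := S.cls_surjective b r
    rw [← map_add, formInf_cls, formInf_cls, formInf_cls]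
    obtain ⟨N1, h1⟩ := S.form_eventually b (f + g) h
    obtain ⟨N2, h2⟩ := S.form_eventually b f h
    obtain ⟨N3, h3⟩ := S.form_eventually b g h
    set M := N1 + N2 + N3
    rw [h1 M (by omega), h2 M (by omega), h3 M (by omega)]
    simp only [sphereForm, ← Finset.sum_add_distrib]
    refine Finset.sum_congr rfl fun x _ => Finset.sum_congr rfl fun a _ => ?_
    split_ifs <;> simp
  smul_left p q r := by
    obtain ⟨f, rfl⟩ := S.cls_surjective b p
    obtain ⟨g, rfl⟩ := S.cls_surjective b q
    rw [← map_smul, formInf_cls, formInf_cls]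
    obtain ⟨N1, h1⟩ := S.form_eventually b (r • f) g
    obtain ⟨N2, h2⟩ := S.form_eventually b f g
    set M := N1 + N2
    rw [h1 M (by omega), h2 M (by omega)]
    simp only [sphereForm, Finset.mul_sum]
    refine Finset.sum_congr rfl fun x _ => Finset.sum_congr rfl fun a _ => ?_
    split_ifs <;> simp
  definite p hp := by
    obtain ⟨f, rfl⟩ := S.cls_surjective b p
    change S.formInf b _ _ = 0 at hp
    rw [formInf_cls] at hp
    obtain ⟨N, hN⟩ := S.form_eventually b f f
    obtain ⟨K, hK⟩ := f.2
    rw [← map_zero (S.cls b), cls_eq_cls, sub_zero]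
    refine (finite_len_le b (N + K)).subset fun y hy => ?_
    by_contra hlen
    simp only [Set.mem_ofPred_eq, not_le] at hlen
    apply hy
    obtain ⟨M, hM⟩ : ∃ M, len b y = M + 1 := ⟨len b y - 1, by omega⟩
    rw [hN M (by omega)] at hp
    have hF : S.sphereForm b M f.1 f.1
        = ∑ z ∈ sphere b (M + 1), ∑ c : Letter ι, S.B c (f.1 z c) (f.1 z c) := by
      rw [sum_sphere_succ, sphereForm]
      refine Finset.sum_congr rfl fun x hx => Finset.sum_congr rfl fun a _ => ?_
      rw [mem_sphere] at hx
      split_ifs with h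
      · rw [Finset.sum_eq_single a]
        · intro c _ hc
          rw [(hK _ (by omega) a (endsWith_mul_letter b h)).1 c hc]
          simp
        · simp
      · rfl
    rw [hF] at hp
    have hp' := congrArg Complex.re hp
    simp only [Complex.re_sum, Complex.zero_re] at hp'
    rw [Finset.sum_eq_zero_iff_of_nonneg
      (fun z _ => Finset.sum_nonneg fun c _ => S.B_self_nonneg c _)] at hp'
    have h1 := hp' y ((mem_sphere b).mpr hM)
    rw [Finset.sum_eq_zero_iff_of_nonneg (fun c _ => S.B_self_nonneg c _)] at h1
    funext c
    by_contra hc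
    exact absurd (h1 c (Finset.mem_univ c)) (S.B_pos c _ hc).ne'

noncomputable instance : NormedAddCommGroup (S.Hinf b) :=
  (S.core b).toNormedAddCommGroup

noncomputable instance : InnerProductSpace ℂ (S.Hinf b) :=
  InnerProductSpace.ofCore (S.core b).toCore

/-- The Hilbert space `ℋ(V_a, H_{ba}, B_a)`: the completion of `ℋ^∞`. -/
abbrev Hilb : Type (max u v) := UniformSpace.Completion (S.Hinf b)

/-- Left translation `(π(g) f)(y) = f(g⁻¹ y)`. -/
def transFun (g : Γ) : (Γ → ∀ a, S.V a) →ₗ[ℂ] (Γ → ∀ a, S.V a) where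
  toFun f y := f (g⁻¹ * y)
  map_add' _ _ := rfl
  map_smul' _ _ := rfl

theorem transFun_letter_mem (a : Letter ι) {f : Γ → ∀ a, S.V a} (hf : f ∈ S.mult b) :
    S.transFun (letter b a)⁻¹ f ∈ S.mult b := by
  obtain ⟨N, hN⟩ := hf
  refine ⟨N + 2, fun y hy c hc => ?_⟩
  obtain ⟨h1, h2⟩ := letter_mul_aux b (y := y) (by omega) a
  have hE : EndsWith b (letter b a * y) c := h1.trans hc
  have h3 := hN (letter b a * y) (by omega) c hE
  simp only [transFun, LinearMap.coe_mk, AddHom.coe_mk, inv_inv]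
  refine ⟨h3.1, fun d hd => ?_⟩
  rw [← mul_assoc]
  apply h3.2
  rw [len_mul_letter_iff] at hd ⊢
  intro h
  exact hd (h1.symm.trans h)

theorem transFun_mem (g : Γ) {f : Γ → ∀ a, S.V a} (hf : f ∈ S.mult b) :
    S.transFun g f ∈ S.mult b := by
  have main : ∀ (L : List (Letter ι)) (f : Γ → ∀ a, S.V a), f ∈ S.mult b →
      S.transFun (b.repr.symm (FreeGroup.mk L))⁻¹ f ∈ S.mult b := by
    intro L
    induction L with
    | nil =>
      intro f hf
      have : S.transFun (b.repr.symm (FreeGroup.mk [] : FreeGroup ι))⁻¹ f = f := by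
        funext y
        simp [transFun, ← FreeGroup.one_eq_mk]
      rwa [this]
    | cons a L ih =>
      intro f hf
      have : S.transFun (b.repr.symm (FreeGroup.mk (a :: L)))⁻¹ f
          = S.transFun (b.repr.symm (FreeGroup.mk L))⁻¹ (S.transFun (letter b a)⁻¹ f) := by
        have h : b.repr.symm (FreeGroup.mk (a :: L))
            = letter b a * b.repr.symm (FreeGroup.mk L) := by
          apply b.repr.injective
          simp [repr_letter]
        funext y
        simp [transFun, h, mul_assoc]
      rw [this]
      exact ih _ (S.transFun_letter_mem b a hf)
  have := main (word b g⁻¹) f hf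
  rwa [word, FreeGroup.mk_toWord, MulEquiv.symm_apply_apply, inv_inv] at this

/-- Left translation on the space of multiplicative functions. -/
def transMult (g : Γ) : S.mult b →ₗ[ℂ] S.mult b :=
  (S.transFun g).restrict fun _ hf => S.transFun_mem b g hf

/-- Left translation `π(g)` on `ℋ^∞`. -/
def trans (g : Γ) : S.Hinf b →ₗ[ℂ] S.Hinf b :=
  (S.null b).mapQ (S.null b) (S.transMult b g) fun f hf => by
    have h : {x | f.1 x ≠ 0}.Finite := hf
    exact h.preimage (mul_right_injective g⁻¹).injOn

end InnerSystem

section Representations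

variable {Γ : Type u} [Group Γ] {ι : Type v} [Fintype ι] [DecidableEq ι]
  {H : Type w} [NormedAddCommGroup H] [InnerProductSpace ℂ H] [CompleteSpace H]

/-- The class `Mult(F_A)`, where `A` is the symmetric set of free generators given by the basis
`b`: there are a system with inner products, a dense subspace `M` of `H` and a unitary operator
`U : H → ℋ` that maps `M` onto `ℋ^∞` and intertwines `ρ` with the left translations. -/
def InMult (b : FreeGroupBasis ι Γ) (ρ : Γ →* unitary (H →L[ℂ] H)) : Prop :=
  ∃ (S : InnerSystem ι) (M : Submodule ℂ H) (U : H ≃ₗᵢ[ℂ] S.Hilb b),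
    Dense (M : Set H) ∧
    U '' (M : Set H) = Set.range ((↑) : S.Hinf b → S.Hilb b) ∧
    ∀ (x : Γ), ∀ m ∈ M, ∀ f : S.Hinf b, U m = (f : S.Hilb b) →
      U ((ρ x : H →L[ℂ] H) m) = (S.trans b x f : S.Hilb b)

/-- The class `Mult(Γ)`: membership in `Mult(F_A)` for some finite symmetric set `A` of free
generators of `Γ`. -/
def InMultGroup (ρ : Γ →* unitary (H →L[ℂ] H)) : Prop :=
  ∃ (n : ℕ) (b : FreeGroupBasis (Fin n) Γ), InMult b ρ

end Representations

end FreeMult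

/-! Multiplicative functions can be cut off by any set `C` that right translations change at
finitely many places only. Modulo finite sets these sets are the clopen subsets of the boundary of
`Γ`, so `ℋ^∞` carries translations together with a covariant family of projections
(`BoundaryAction`). Nothing in this structure refers to a basis.

Any other basis can then be used to decompose a vector `f`: restrict it to the cone of `x` and
translate back, `loc x f = π(x⁻¹) P(cone x) f`. Cones are nested, so `loc c (loc x f) = loc (xc) f`
when `xc` is reduced (`loc_letter_loc`). Cones of equal radius partition `Γ` up to a finite set, so
the squared norms of the pieces add up (`sum_inner_loc`). Hence `x ↦ loc x f` is a multiplicative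
function whose matrices are the maps `loc c` and whose forms are restrictions of the inner product,
provided that the pieces with last letter `a` eventually lie in a finite-dimensional space `W a`
stable under these maps (`LocalFamily`, `exists_equiv`).

Finite dimension is the crux. Left multiplication by `x` without cancellation in the new basis
preserves the last old letter of `y`, except for `y` in a finite set independent of `x`
(`exists_getLast_mul_eq`). So the translated pieces are multiplicative from one common radius `N` on
(`exists_isMultFrom_translate_indicator`), and modulo finite sets such functions are determined by
their values on one sphere (`finiteDimensional_map_multFrom`).

For an automorphism `φ`, the map `f ↦ f ∘ φ` keeps the matrix system and replaces the basis by its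
preimage under `φ`; a change of basis leads back. -/

open FreeGroup (IsReduced)

namespace FreeMult

universe u v w

/-! ### Reduced words, cones and almost invariant sets. -/

section Cones

variable {Γ : Type u} [Group Γ] {ι : Type v}

theorem Letter.inv_inv (a : Letter ι) : a.inv.inv = a := by simp [Letter.inv]

/-- The right-hand side is the relation between neighbouring letters in `FreeGroup.IsReduced`. -/
theorem letter_ne_iff {a c : Letter ι} : c ≠ a.inv ↔ (a.1 = c.1 → a.2 = c.2) := by
  obtain ⟨i, s⟩ := a
  obtain ⟨j, t⟩ := c
  simp only [Letter.inv, ne_eq, Prod.mk.injEq, not_and]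
  constructor
  · intro h e
    have := h e.symm
    revert this
    cases s <;> cases t <;> simp
  · intro h e
    have := h e.symm
    revert this
    cases s <;> cases t <;> simp

theorem letter_inv (b : FreeGroupBasis ι Γ) (a : Letter ι) : letter b a.inv = (letter b a)⁻¹ := by
  obtain ⟨i, s⟩ := a
  cases s <;> simp [letter, Letter.inv]

theorem letter_induction (b : FreeGroupBasis ι Γ) {p : Γ → Prop} (one : p 1)
    (letter_mul : ∀ a x, p x → p (letter b a * x)) (g : Γ) : p g := by
  have main : ∀ L : List (Letter ι), p (b.repr.symm (FreeGroup.mk L)) := by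
    intro L
    induction L with
    | nil => simpa [← FreeGroup.one_eq_mk] using one
    | cons a L ih =>
      have h : b.repr.symm (FreeGroup.mk (a :: L))
          = letter b a * b.repr.symm (FreeGroup.mk L) := by
        apply b.repr.injective
        simp [repr_letter]
      rw [h]
      exact letter_mul a _ ih
  obtain ⟨L, hL⟩ := Quot.exists_rep (b.repr g)
  have h := main L
  rwa [show FreeGroup.mk L = b.repr g from hL, MulEquiv.symm_apply_apply] at h

variable [DecidableEq ι] (b : FreeGroupBasis ι Γ)

theorem exists_word_eq {L : List (Letter ι)} (h : IsReduced L) : ∃ x, word b x = L :=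
  ⟨b.repr.symm (FreeGroup.mk L), by simp [word, h.reduce_eq]⟩

theorem word_mul (x y : Γ) : word b (x * y) = FreeGroup.reduce (word b x ++ word b y) := by
  simp [word, FreeGroup.toWord_mul]

theorem word_one : word b (1 : Γ) = [] := by simp [word]

theorem word_letter (a : Letter ι) : word b (letter b a) = [a] := by
  simp [word, repr_letter]

theorem len_eq_zero {x : Γ} : len b x = 0 ↔ x = 1 := by
  rw [len, List.length_eq_zero_iff, ← word_one b, (word_injective b).eq_iff]

theorem len_letter (a : Letter ι) : len b (letter b a) = 1 := by simp [len, word_letter]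

theorem exists_endsWith {x : Γ} (hx : 1 ≤ len b x) : ∃ a, EndsWith b x a := by
  have hne : word b x ≠ [] := by
    intro h
    simp [len, h] at hx
  exact ⟨_, List.getLast?_eq_some_getLast hne⟩

theorem EndsWith.unique {b : FreeGroupBasis ι Γ} {x : Γ} {a c : Letter ι} (ha : EndsWith b x a)
    (hc : EndsWith b x c) : a = c := Option.some.inj (ha.symm.trans hc)

/-- The cone of `x`: the elements whose reduced words start with that of `x`. -/
def cone (x : Γ) : Set Γ := {y | word b x <+: word b y}

/-- The elements whose reduced words can follow the letter `a`. -/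
def follow (a : Letter ι) : Set Γ := (cone b (letter b a.inv))ᶜ

variable {b}

theorem mem_cone {x y : Γ} : y ∈ cone b x ↔ word b x <+: word b y := Iff.rfl

theorem len_le_of_mem_cone {x y : Γ} (h : y ∈ cone b x) : len b x ≤ len b y := h.length_le

/-- If the word of `x * y` continues that of `x` by a suffix spelling `z`, then `x * y = x * z`, so
the suffix is the word of `y`. -/
theorem mul_mem_cone_iff {x y : Γ} : x * y ∈ cone b x ↔ IsReduced (word b x ++ word b y) := by
  constructor
  · rintro ⟨t, ht⟩
    have hr : IsReduced (word b x ++ t) := ht ▸ isReduced_word b _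
    obtain ⟨z, hz⟩ := exists_word_eq b (hr.infix (List.suffix_append _ _).isInfix)
    have : x * y = x * z := by
      apply word_injective b
      rw [word_mul b x z, hz, hr.reduce_eq, ht]
    rw [mul_left_cancel this, hz]
    exact hr
  · intro h
    rw [mem_cone, word_mul, h.reduce_eq]
    exact List.prefix_append _ _

theorem word_mul_of_mem_cone {x y : Γ} (h : x * y ∈ cone b x) :
    word b (x * y) = word b x ++ word b y := by
  rw [word_mul, (mul_mem_cone_iff.mp h).reduce_eq]

theorem mem_follow {a : Letter ι} {y : Γ} :
    y ∈ follow b a ↔ ∀ c ∈ (word b y).head?, c ≠ a.inv := by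
  rw [follow, Set.mem_compl_iff, mem_cone, word_letter]
  cases word b y with
  | nil => simp
  | cons d l => simp [List.cons_prefix_cons, eq_comm]

/-- Cancellation is decided at the junction of the two words, so the cone of `x`, pulled back by
`x`, depends on the last letter of `x` only. Up to translation there are thus finitely many cones
other than `Γ`. -/
theorem mul_mem_cone_iff_mem_follow {x y : Γ} {a : Letter ι} (h : EndsWith b x a) :
    x * y ∈ cone b x ↔ y ∈ follow b a := by
  rw [mul_mem_cone_iff, FreeGroup.IsReduced, List.isChain_append, mem_follow]
  have hx := isReduced_word b x
  have hy := isReduced_word b y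
  unfold FreeGroup.IsReduced at hx hy
  rw [EndsWith] at h
  simp only [hx, hy, h, true_and, Option.mem_def, Option.some.injEq, letter_ne_iff]
  constructor
  · intro h' c hc
    exact h' a rfl c hc
  · rintro h' _ rfl c hc
    exact h' c hc

theorem mul_mem_cone_mul_letter_iff {x y : Γ} {c : Letter ι}
    (h : len b (x * letter b c) = len b x + 1) :
    x * y ∈ cone b (x * letter b c) ↔ y ∈ cone b (letter b c) := by
  have hw := word_mul_letter_of_ne b ((len_mul_letter_iff b x c).mp h)
  have hr : IsReduced (word b x ++ [c]) := hw ▸ isReduced_word b _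
  constructor
  · intro hy
    have h1 : x * y ∈ cone b x := by
      rw [mem_cone, hw] at hy
      exact (List.prefix_append _ _).trans hy
    rw [mem_cone, hw, word_mul_of_mem_cone h1, List.prefix_append_right_inj] at hy
    rwa [mem_cone, word_letter]
  · intro hy
    rw [mem_cone, word_letter] at hy
    have h1 : IsReduced (word b x ++ word b y) := by
      obtain ⟨t, ht⟩ := hy
      rw [← ht, ← List.append_assoc]
      exact hr.append_overlap (ht ▸ isReduced_word b y) (by simp)
    rw [mem_cone, hw, word_mul, h1.reduce_eq, List.prefix_append_right_inj]
    exact hy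

theorem cone_mul_letter_subset {x : Γ} {c : Letter ι}
    (h : len b (x * letter b c) = len b x + 1) : cone b (x * letter b c) ⊆ cone b x := by
  intro y hy
  rw [mem_cone, word_mul_letter_of_ne b ((len_mul_letter_iff b x c).mp h)] at hy
  exact (List.prefix_append _ _).trans hy

theorem eq_of_mem_cone {x x' y : Γ} (hl : len b x = len b x') (hx : y ∈ cone b x)
    (hx' : y ∈ cone b x') : x = x' :=
  word_injective b ((List.prefix_of_prefix_length_le hx hx' hl.le).eq_of_length hl)

theorem exists_mem_cone {y : Γ} {N : ℕ} (h : N ≤ len b y) : ∃ x, len b x = N ∧ y ∈ cone b x := by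
  obtain ⟨x, hx⟩ := exists_word_eq b
    ((isReduced_word b y).infix (List.take_prefix N (word b y)).isInfix)
  refine ⟨x, ?_, ?_⟩
  · rw [len, hx, List.length_take]
    exact min_eq_left h
  · rw [mem_cone, hx]
    exact List.take_prefix _ _

/-- A set that right translations change only at finitely many places. -/
def AlmostInvariant (C : Set Γ) : Prop := ∀ s, {y | ¬ (y ∈ C ↔ y * s ∈ C)}.Finite

theorem AlmostInvariant.compl {C : Set Γ} (h : AlmostInvariant C) : AlmostInvariant Cᶜ := by
  intro s
  refine (h s).subset fun y hy => ?_
  simp only [Set.mem_ofPred_eq, Set.mem_compl_iff] at hy ⊢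
  tauto

theorem AlmostInvariant.inter {C D : Set Γ} (h : AlmostInvariant C) (h' : AlmostInvariant D) :
    AlmostInvariant (C ∩ D) := by
  intro s
  refine ((h s).union (h' s)).subset fun y hy => ?_
  simp only [Set.mem_ofPred_eq, Set.mem_inter_iff, Set.mem_union] at hy ⊢
  tauto

theorem AlmostInvariant.translate {C : Set Γ} (h : AlmostInvariant C) (g : Γ) :
    AlmostInvariant ((fun y => g * y) ⁻¹' C) := by
  intro s
  refine ((h s).preimage (mul_right_injective g).injOn).subset fun y hy => ?_
  simpa [mul_assoc] using hy

/-- Right multiplication by a letter adds or removes one letter at the end, which cannot affect a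
prefix of length `|x|` of a longer word. -/
theorem almostInvariant_cone [Finite ι] (x : Γ) : AlmostInvariant (cone b x) := by
  intro s
  induction s using letter_induction b with
  | one => simp
  | letter_mul a s ih =>
    refine ((finite_len_le b (len b x + 1)).union
      (ih.preimage (mul_left_injective (letter b a)).injOn)).subset fun y hy => ?_
    simp only [Set.mem_union, Set.mem_preimage, Set.mem_ofPred_eq] at hy ⊢
    by_contra! hcon
    obtain ⟨h1, h2⟩ := hcon
    apply hy
    rw [← mul_assoc, ← h2, mem_cone, mem_cone]
    by_cases h : EndsWith b y a.inv
    · have hw := word_mul_letter_of_endsWith b h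
      rw [hw, List.prefix_concat_iff]
      refine ⟨fun h' => h'.resolve_left fun e => ?_, Or.inr⟩
      rw [← hw] at e
      simp only [len, e] at h1
      omega
    · rw [word_mul_letter_of_ne b h, List.prefix_concat_iff]
      refine ⟨Or.inr, fun h' => h'.resolve_left fun e => ?_⟩
      have := congrArg List.length e
      simp only [len, List.length_append, List.length_singleton] at h1 this
      omega

theorem almostInvariant_follow [Finite ι] (a : Letter ι) : AlmostInvariant (follow b a) :=
  (almostInvariant_cone _).compl

theorem letter_mul_mem_cone {x y : Γ} (hx : 2 ≤ len b x) (hy : y ∈ cone b x) (a : Letter ι) :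
    letter b a * y ∈ cone b (letter b a * x) := by
  rw [mem_cone, word_letter_mul, word_letter_mul, FreeGroup.reduce.cons, FreeGroup.reduce.cons,
    (isReduced_word b x).reduce_eq, (isReduced_word b y).reduce_eq]
  obtain ⟨t, ht⟩ := hy
  rw [len] at hx
  rw [← ht]
  match hw : word b x, hx with
  | c :: d :: l, _ =>
    simp only [List.cons_append]
    split_ifs <;> simp [List.cons_prefix_cons]

theorem finite_getLast_mul_ne [Finite ι] (b : FreeGroupBasis ι Γ) (g : Γ) :
    {x | (word b (g * x)).getLast? ≠ (word b x).getLast?}.Finite := by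
  induction g using letter_induction b with
  | one => simp
  | letter_mul a g ih =>
    refine (ih.union ((finite_len_le b 1).preimage (mul_right_injective g).injOn)).subset
      fun x hx => ?_
    simp only [Set.mem_union, Set.mem_preimage, Set.mem_ofPred_eq] at hx ⊢
    by_contra! h
    apply hx
    rw [← h.1, mul_assoc]
    exact (letter_mul_aux b (by omega) a).1

theorem finite_cone_translate [Finite ι] (b : FreeGroupBasis ι Γ) (g : Γ) :
    {x | ¬ ∀ y, g * y ∈ cone b (g * x) ↔ y ∈ cone b x}.Finite := by
  induction g using letter_induction b with
  | one => simp
  | letter_mul a g ih =>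
    -- Outside radius 2, both `g * x` and `a * g * x` have length at least 2, so
    -- `letter_mul_mem_cone` applies to `a` and, for the converse, to `a⁻¹`.
    refine (ih.union ((finite_len_le b 2).preimage (mul_right_injective g).injOn)).subset
      fun x hx => ?_
    simp only [Set.mem_union, Set.mem_preimage, Set.mem_ofPred_eq] at hx ⊢
    by_contra! h
    apply hx
    intro y
    rw [← h.1 y, mul_assoc, mul_assoc]
    have h2 := (letter_mul_aux b (y := g * x) (by omega) a).2
    refine ⟨fun h' => ?_, fun h' => letter_mul_mem_cone (by omega) h' a⟩
    have := letter_mul_mem_cone (by omega) h' a.inv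
    simpa [letter_inv] using this

/-- The last letter in the alphabet of `b'` is stable under left multiplications without
cancellation in the alphabet of `b`. -/
theorem exists_getLast_mul_eq [Finite ι] {κ : Type w} [Finite κ] [DecidableEq κ]
    (b : FreeGroupBasis ι Γ) (b' : FreeGroupBasis κ Γ) :
    ∃ K, ∀ x y, K < len b y → x * y ∈ cone b x →
      (word b' (x * y)).getLast? = (word b' y).getLast? := by
  have hfin : (⋃ a : Letter ι,
      {z | (word b' (letter b a * z)).getLast? ≠ (word b' z).getLast?}).Finite :=
    Set.finite_iUnion fun a => finite_getLast_mul_ne b' _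
  obtain ⟨K, hK⟩ := (hfin.image (len b)).bddAbove
  have hK' : ∀ a z, K < len b z →
      (word b' (letter b a * z)).getLast? = (word b' z).getLast? := by
    intro a z hz
    by_contra h
    have : len b z ≤ K := hK ⟨z, Set.mem_iUnion.mpr ⟨a, h⟩, rfl⟩
    omega
  refine ⟨K, fun x y hy hxy => ?_⟩
  rw [mul_mem_cone_iff] at hxy
  generalize hL : word b x = L at hxy
  induction L generalizing x with
  | nil =>
    rw [← word_one b] at hL
    rw [word_injective b hL, one_mul]
  | cons a L ih =>
    have hLr : IsReduced L := hxy.infix ⟨[a], word b y, by simp⟩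
    obtain ⟨x', hx'⟩ := exists_word_eq b hLr
    have hr : IsReduced (L ++ word b y) := hxy.infix ⟨[a], [], by simp⟩
    have hx : x = letter b a * x' := by
      apply word_injective b
      rw [word_letter_mul, hx', ← hL, (isReduced_word b x).reduce_eq]
    -- Without cancellation no partial product is shorter than `y`, so each one-letter step stays
    -- outside the finite exceptional set bounded by `K`.
    have hlen : len b y ≤ len b (x' * y) := by
      rw [len, len, word_mul, hx', hr.reduce_eq, List.length_append]
      omega
    rw [hx, mul_assoc, hK' a _ (by omega), ih x' hx' hr]

end Cones

/-! ### Boundary actions and localization at cones. -/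

/-- An isometric action of `Γ` on an inner product space `E`, together with a compatible
projection-valued measure on the Boolean algebra of almost invariant subsets of `Γ` modulo finite
sets (the algebra of clopen subsets of the boundary). -/
structure BoundaryAction (Γ : Type u) [Group Γ] (E : Type w) [NormedAddCommGroup E]
    [InnerProductSpace ℂ E] where
  π : Γ → E →ₗ[ℂ] E
  π_one : ∀ f, π 1 f = f
  π_mul : ∀ g h f, π (g * h) f = π g (π h f)
  inner_π : ∀ g f f', inner ℂ (π g f) (π g f') = inner ℂ f f'
  P : Set Γ → E →ₗ[ℂ] E
  P_empty : ∀ f, P ∅ f = 0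
  P_inter : ∀ {C D}, AlmostInvariant C → AlmostInvariant D → ∀ f, P C (P D f) = P (C ∩ D) f
  P_symm : ∀ {C}, AlmostInvariant C → ∀ f f', inner ℂ (P C f) f' = inner ℂ f (P C f')
  P_partition : ∀ (s : Finset Γ) (C : Γ → Set Γ), (∀ x ∈ s, AlmostInvariant (C x)) →
    {y | ¬ ∃! x, x ∈ s ∧ y ∈ C x}.Finite → ∀ f, ∑ x ∈ s, P (C x) f = f
  π_P : ∀ g {C}, AlmostInvariant C → ∀ f, π g⁻¹ (P C f) = P ((fun y => g * y) ⁻¹' C) (π g⁻¹ f)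

namespace BoundaryAction

variable {Γ : Type u} [Group Γ] {ι : Type v} [DecidableEq ι]
  {E : Type w} [NormedAddCommGroup E] [InnerProductSpace ℂ E]
  (A : BoundaryAction Γ E) (b : FreeGroupBasis ι Γ)

/-- Restriction to the cone of `x`, translated back by `x`. -/
noncomputable def loc (x : Γ) : E →ₗ[ℂ] E := A.π x⁻¹ ∘ₗ A.P (cone b x)

theorem loc_apply (x : Γ) (f : E) : A.loc b x f = A.π x⁻¹ (A.P (cone b x) f) := rfl

theorem π_inv_π (x : Γ) (f : E) : A.π x⁻¹ (A.π x f) = f := by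
  rw [← A.π_mul, inv_mul_cancel, A.π_one]

theorem π_π_inv (x : Γ) (f : E) : A.π x (A.π x⁻¹ f) = f := by
  rw [← A.π_mul, mul_inv_cancel, A.π_one]

variable {b}

variable [Fintype ι]

/-- This cocycle identity is the future multiplicativity relation, with `loc c` as matrix: pulled
back by `x`, the cone of `xc` becomes the cone of `c`. -/
theorem loc_letter_loc {x : Γ} {c : Letter ι} (h : len b (x * letter b c) = len b x + 1) (f : E) :
    A.loc b (letter b c) (A.loc b x f) = A.loc b (x * letter b c) f := by
  have h1 : cone b (x * letter b c) ∩ cone b x = cone b (x * letter b c) :=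
    Set.inter_eq_left.mpr (cone_mul_letter_subset h)
  have h2 : (fun y => x * y) ⁻¹' cone b (x * letter b c) = cone b (letter b c) :=
    Set.ext fun y => mul_mem_cone_mul_letter_iff h
  rw [loc_apply, loc_apply, loc_apply, mul_inv_rev, A.π_mul, ← h1,
    ← A.P_inter (almostInvariant_cone _) (almostInvariant_cone _),
    A.π_P x (almostInvariant_cone (x * letter b c)), h2]

theorem P_follow_loc {x : Γ} {a : Letter ι} (h : EndsWith b x a) (f : E) :
    A.P (follow b a) (A.loc b x f) = A.loc b x f := by
  have h2 : (fun y => x * y) ⁻¹' cone b x = follow b a :=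
    Set.ext fun y => mul_mem_cone_iff_mem_follow h
  rw [loc_apply, ← h2, ← A.π_P x (almostInvariant_cone _),
    A.P_inter (almostInvariant_cone _) (almostInvariant_cone _), Set.inter_self]

theorem P_cone_π {x : Γ} {a : Letter ι} (h : EndsWith b x a) {v : E}
    (hv : A.P (follow b a) v = v) : A.P (cone b x) (A.π x v) = A.π x v := by
  have h2 : (fun y => x * y) ⁻¹' cone b x = follow b a :=
    Set.ext fun y => mul_mem_cone_iff_mem_follow h
  rw [← A.π_π_inv x (A.P (cone b x) (A.π x v)), A.π_P x (almostInvariant_cone _), h2, π_inv_π, hv]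

/-- Translates of admissible vectors to distinct points of one sphere live on disjoint cones. This
lets a vector be rebuilt from prescribed localizations. -/
theorem loc_π {x x' : Γ} {a : Letter ι} (h : EndsWith b x a) (hl : len b x' = len b x) {v : E}
    (hv : A.P (follow b a) v = v) [Decidable (x' = x)] :
    A.loc b x' (A.π x v) = if x' = x then v else 0 := by
  split_ifs with he
  · rw [he, loc_apply, A.P_cone_π h hv, π_inv_π]
  · have : cone b x' ∩ cone b x = ∅ := by
      rw [Set.eq_empty_iff_forall_notMem]
      rintro y ⟨hy, hy'⟩
      exact he (eq_of_mem_cone hl hy hy')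
    rw [loc_apply, ← A.P_cone_π h hv, A.P_inter (almostInvariant_cone _) (almostInvariant_cone _),
      this, A.P_empty, map_zero]

/-- Parseval's identity for the projections onto the cones of radius `N`, which partition `Γ`
outside a ball. -/
theorem sum_inner_loc (N : ℕ) (f f' : E) :
    ∑ x ∈ sphere b N, inner ℂ (A.loc b x f) (A.loc b x f') = inner ℂ f f' := by
  have h := A.P_partition (sphere b N) (cone b) (fun x _ => almostInvariant_cone x)
    ((finite_len_le b N).subset fun y hy => by
      by_contra hN
      simp only [Set.mem_ofPred_eq, not_le] at hN
      obtain ⟨x, hx, hyx⟩ := exists_mem_cone hN.le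
      refine hy ⟨x, ⟨(mem_sphere b).mpr hx, hyx⟩, ?_⟩
      rintro x' ⟨hx', hyx'⟩
      exact eq_of_mem_cone (((mem_sphere b).mp hx').trans hx.symm) hyx' hyx) f
  conv_rhs => rw [← h, sum_inner]
  refine Finset.sum_congr rfl fun x _ => ?_
  rw [loc_apply, loc_apply, A.inner_π, ← A.P_symm (almostInvariant_cone _),
    A.P_inter (almostInvariant_cone _) (almostInvariant_cone _), Set.inter_self]

/-- The case of radius 1, which yields the compatibility condition of the matrix system. -/
theorem sum_letter_inner_loc (f f' : E) :
    ∑ c : Letter ι, inner ℂ (A.loc b (letter b c) f) (A.loc b (letter b c) f') = inner ℂ f f' := by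
  have h0 : sphere b 0 = {1} := by
    ext x
    rw [mem_sphere, len_eq_zero, Finset.mem_singleton]
  rw [← A.sum_inner_loc (b := b) (0 + 1),
    sum_sphere_succ b 0 fun x => inner ℂ (A.loc b x f) (A.loc b x f'), h0, Finset.sum_singleton]
  refine Finset.sum_congr rfl fun c _ => ?_
  rw [one_mul, if_pos]
  rw [len_letter, (len_eq_zero b).mpr rfl]

theorem loc_translate {g x : Γ} (h : ∀ y, g⁻¹ * y ∈ cone b (g⁻¹ * x) ↔ y ∈ cone b x) (f : E) :
    A.loc b x (A.π g f) = A.loc b (g⁻¹ * x) f := by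
  have h2 : (fun y => g⁻¹ * y) ⁻¹' cone b (g⁻¹ * x) = cone b x := Set.ext h
  have h3 := A.π_P g⁻¹ (almostInvariant_cone (b := b) (g⁻¹ * x)) f
  rw [h2, inv_inv] at h3
  rw [loc_apply, loc_apply, ← h3, ← A.π_mul, mul_inv_rev, inv_inv]

/-! ### From a local family to a matrix system. -/

/-- Finite-dimensional spaces `W a` of vectors supported on `follow b a` that are stable under
localization and eventually contain all localizations of any vector. -/
structure LocalFamily (A : BoundaryAction Γ E) (b : FreeGroupBasis ι Γ) where
  W : Letter ι → Submodule ℂ E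
  finiteDimensional : ∀ a, FiniteDimensional ℂ (W a)
  P_follow : ∀ {a v}, v ∈ W a → A.P (follow b a) v = v
  loc_mem : ∀ {a c v}, v ∈ W a → c ≠ a.inv → A.loc b (letter b c) v ∈ W c
  eventually_mem : ∀ f, ∃ N, ∀ x a, N ≤ len b x → EndsWith b x a → A.loc b x f ∈ W a

namespace LocalFamily

variable {A}

theorem loc_inv (L : LocalFamily A b) {a : Letter ι} {v : E} (hv : v ∈ L.W a) : A.loc b (letter b a.inv) v = 0 := by
  rw [loc_apply, ← L.P_follow hv,
    A.P_inter (almostInvariant_cone _) (almostInvariant_follow _), follow, Set.inter_compl_self,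
    A.P_empty, map_zero]

theorem loc_mem' (L : LocalFamily A b) {a : Letter ι} (c : Letter ι) {v : E} (hv : v ∈ L.W a) :
    A.loc b (letter b c) v ∈ L.W c := by
  by_cases h : c = a.inv
  · rw [h, L.loc_inv hv]
    exact zero_mem _
  · exact L.loc_mem hv h

/-- The system with inner products carried by a local family, in coordinates. -/
theorem exists_system (L : LocalFamily A b) : ∃ (S : InnerSystem ι) (i : ∀ a, S.V a →ₗ[ℂ] E),
    (∀ a, Function.Injective (i a)) ∧ (∀ a, LinearMap.range (i a) = L.W a) ∧
    (∀ c a v, i c (S.H c a v) = A.loc b (letter b c) (i a v)) ∧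
    ∀ a v v', S.B a v v' = inner ℂ (i a v) (i a v') := by
  have := L.finiteDimensional
  -- `InnerSystem.V` takes values in `Type`, while `W a` lives in the universe of `E`; hence
  -- coordinates.
  let V : Letter ι → Type := fun a => Fin (Module.finrank ℂ (L.W a)) → ℂ
  let e : ∀ a, V a ≃ₗ[ℂ] L.W a := fun a => (Module.finBasis ℂ (L.W a)).equivFun.symm
  let i : ∀ a, V a →ₗ[ℂ] E := fun a => (L.W a).subtype ∘ₗ (e a).toLinearMap
  have i_mem : ∀ a v, i a v ∈ L.W a := fun a v => (e a v).2
  have i_inj : ∀ a, Function.Injective (i a) := fun a =>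
    (L.W a).injective_subtype.comp (e a).injective
  let H : ∀ c a, V a →ₗ[ℂ] V c := fun c a => (e c).symm.toLinearMap ∘ₗ
    (A.loc b (letter b c) ∘ₗ i a).codRestrict (L.W c) fun v => L.loc_mem' c (i_mem a v)
  have i_H : ∀ c a v, i c (H c a v) = A.loc b (letter b c) (i a v) := by
    intro c a v
    simp [i, H]
  let B : ∀ a, V a →ₗ⋆[ℂ] V a →ₗ[ℂ] ℂ := fun a =>
    LinearMap.mk₂'ₛₗ (starRingEnd ℂ) (RingHom.id ℂ) (fun v v' => inner ℂ (i a v) (i a v'))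
      (fun _ _ _ => by rw [map_add, inner_add_left])
      (fun _ _ _ => by rw [map_smul, inner_smul_left]; rfl)
      (fun _ _ _ => by rw [map_add, inner_add_right])
      (fun _ _ _ => by rw [map_smul, inner_smul_right]; rfl)
  have hB : ∀ a v v', B a v v' = inner ℂ (i a v) (i a v') := fun _ _ _ => rfl
  refine ⟨{ V := V, H := H, B := B, H_inv := ?_, B_symm := ?_, B_pos := ?_, compat := ?_ }, i,
    i_inj, ?_, i_H, hB⟩
  · intro a
    refine LinearMap.ext fun v => i_inj _ ?_
    rw [i_H, L.loc_inv (i_mem a v), LinearMap.zero_apply, map_zero]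
  · intro a v w
    rw [hB, hB, inner_conj_symm]
  · intro a v hv
    rw [hB]
    have : i a v ≠ 0 := fun h => hv (i_inj a (h.trans (map_zero _).symm))
    exact (pow_pos (norm_pos_iff.mpr this) 2).trans_eq (inner_self_eq_norm_sq (𝕜 := ℂ) _).symm
  · intro a v
    simp only [hB, i_H]
    rw [A.sum_letter_inner_loc]
  · intro a
    rw [LinearMap.range_comp, LinearEquiv.range, Submodule.map_top, Submodule.range_subtype]

/-- A boundary action with a local family is the left translation on the space of multiplicative
functions of some system. -/
theorem exists_equiv (L : LocalFamily A b) : ∃ (S : InnerSystem ι) (Φ : E ≃ₗᵢ[ℂ] S.Hinf b),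
    ∀ g f, Φ (A.π g f) = S.trans b g (Φ f) := by
  classical
  obtain ⟨S, i, i_inj, i_range, i_H, hB⟩ := L.exists_system
  have i_mem : ∀ a v, i a v ∈ L.W a := fun a v => i_range a ▸ LinearMap.mem_range_self _ v
  -- `r a` is defined on all of `E`, but is an inverse of `i a` on `W a` only. Its other values
  -- enter `F` at finitely many `x`, which `ℋ^∞` ignores.
  choose r hr using fun a =>
    (i a).exists_leftInverse_of_injective (LinearMap.ker_eq_bot.mpr (i_inj a))
  have r_i : ∀ a v, r a (i a v) = v := fun a v => LinearMap.congr_fun (hr a) v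
  have i_r : ∀ a f, f ∈ L.W a → i a (r a f) = f := by
    intro a f hf
    rw [← i_range a] at hf
    obtain ⟨v, rfl⟩ := hf
    rw [r_i]
  let F : E → Γ → ∀ a, S.V a := fun f x c => if EndsWith b x c then r c (A.loc b x f) else 0
  have F_apply : ∀ f {x a}, EndsWith b x a → F f x a = r a (A.loc b x f) := fun f x a h => if_pos h
  have F_mult : ∀ f N, (∀ x a, N ≤ len b x → EndsWith b x a → A.loc b x f ∈ L.W a) →
      S.IsMultFrom b N (F f) := by
    intro f N hN x hx a ha
    refine ⟨fun c hc => if_neg fun h => hc (h.unique ha), fun c hc => ?_⟩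
    have hE := endsWith_mul_letter b hc
    funext d
    by_cases hd : d = c
    · subst hd
      rw [Pi.single_eq_same]
      apply i_inj
      rw [i_H, F_apply f hE, F_apply f ha, i_r _ _ (hN x a hx ha),
        i_r _ _ (hN _ _ (by omega) hE), A.loc_letter_loc hc]
    · rw [Pi.single_eq_of_ne hd]
      exact if_neg fun h => hd (h.unique hE)
  let toMult : E →ₗ[ℂ] S.mult b :=
    { toFun := fun f => ⟨F f, (L.eventually_mem f).imp fun N hN => F_mult f N hN⟩
      map_add' := fun f f' => by
        apply Subtype.ext
        funext x c
        simp only [F, Submodule.coe_add, Pi.add_apply, map_add]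
        split_ifs <;> simp
      map_smul' := fun t f => by
        apply Subtype.ext
        funext x c
        simp only [F, Submodule.coe_smul, Pi.smul_apply, map_smul, RingHom.id_apply]
        split_ifs <;> simp }
  have toMult_inner : ∀ f f', S.form b (toMult f) (toMult f') = inner ℂ f f' := by
    intro f f'
    obtain ⟨N, hN⟩ := L.eventually_mem f
    obtain ⟨N', hN'⟩ := L.eventually_mem f'
    obtain ⟨K, hK⟩ := S.form_eventually b (toMult f) (toMult f')
    set M := N + N' + K
    rw [hK M (by omega), InnerSystem.sphereForm, ← A.sum_inner_loc (b := b) (M + 1),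
      sum_sphere_succ b M fun x => inner ℂ (A.loc b x f) (A.loc b x f')]
    refine Finset.sum_congr rfl fun x hx => Finset.sum_congr rfl fun a _ => ?_
    rw [mem_sphere] at hx
    split_ifs with h
    · have hE := endsWith_mul_letter b h
      rw [hB]
      change inner ℂ (i a (F f _ a)) (i a (F f' _ a)) = _
      rw [F_apply f hE, F_apply f' hE, i_r _ _ (hN _ _ (by omega) hE),
        i_r _ _ (hN' _ _ (by omega) hE)]
    · rfl
  let Ψ : E →ₗᵢ[ℂ] S.Hinf b := (S.cls b ∘ₗ toMult).isometryOfInner fun f f' =>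
    (S.formInf_cls b (toMult f) (toMult f')).trans (toMult_inner f f')
  have Ψ_apply : ∀ f, Ψ f = S.cls b (toMult f) := fun _ => rfl
  have Ψ_surj : Function.Surjective Ψ := by
    intro p
    obtain ⟨⟨G, N, hG⟩, rfl⟩ := S.cls_surjective b p
    -- The extra 1 ensures that every element of the sphere has a last letter.
    set M := N + 1
    let f : E := ∑ x ∈ sphere b M, ∑ a, A.π x (i a (G x a))
    -- On the sphere of radius `M` this is `loc_π`; further out both sides obey the same recursion.
    have key : ∀ n, M ≤ n → ∀ x a, len b x = n → EndsWith b x a → A.loc b x f = i a (G x a) := by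
      intro n hn
      induction n, hn using Nat.le_induction with
      | base =>
        intro x a hx ha
        have hx' : x ∈ sphere b M := (mem_sphere b).mpr hx
        simp only [f, map_sum]
        have hterm : ∀ z ∈ sphere b M, ∀ d : Letter ι,
            A.loc b x (A.π z (i d (G z d))) = if x = z then i d (G z d) else 0 := by
          intro z hz d
          rw [mem_sphere] at hz
          by_cases hd : EndsWith b z d
          · exact A.loc_π hd (hx.trans hz.symm) (L.P_follow (i_mem _ _))
          · obtain ⟨d', hd'⟩ := exists_endsWith b (x := z) (by omega)
            rw [(hG z (by omega) d' hd').1 d fun e => hd (e ▸ hd')]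
            simp
        rw [Finset.sum_congr rfl fun z hz => Finset.sum_congr rfl fun d _ => hterm z hz d,
          Finset.sum_eq_single x, Finset.sum_eq_single a]
        · rw [if_pos rfl]
        · intro d _ hd
          rw [if_pos rfl, (hG x (by omega) a ha).1 d hd, map_zero]
        · simp
        · intro z _ hz
          exact Finset.sum_eq_zero fun d _ => if_neg hz.symm
        · exact fun h => absurd hx' h
      | succ n hn ih =>
        intro y c hy hc
        obtain ⟨x, a, hx, ha, rfl, hl⟩ : ∃ x a, len b x = n ∧ EndsWith b x a ∧
            x * letter b c = y ∧ len b (x * letter b c) = len b x + 1 := by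
          have hE : EndsWith b y c.inv.inv := by rwa [Letter.inv_inv]
          have h1 := congrArg List.length (word_mul_letter_of_endsWith b hE)
          simp only [List.length_append, List.length_singleton] at h1
          have hlen : len b (y * letter b c.inv) = n := by
            simp only [len] at hy ⊢
            omega
          obtain ⟨a, ha⟩ := exists_endsWith b (x := y * letter b c.inv) (by omega)
          have hm : y * letter b c.inv * letter b c = y := by
            rw [letter_inv, inv_mul_cancel_right]
          exact ⟨_, a, hlen, ha, hm, by rw [hm]; omega⟩
        rw [← A.loc_letter_loc hl, ih x a hx ha, ← i_H, (hG x (by omega) a ha).2 c hl,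
          Pi.single_eq_same]
    refine ⟨f, ?_⟩
    rw [Ψ_apply, InnerSystem.cls_eq_cls]
    refine (finite_len_le b M).subset fun x hx => ?_
    by_contra hlen
    simp only [Set.mem_ofPred_eq, not_le] at hlen
    obtain ⟨a, ha⟩ := exists_endsWith b (x := x) (by omega)
    apply hx
    change F f x - G x = 0
    rw [sub_eq_zero]
    funext c
    by_cases hc : c = a
    · rw [hc, F_apply f ha, key _ hlen.le x a rfl ha, r_i]
    · rw [(hG x (by omega) a ha).1 c hc]
      exact if_neg fun h => hc (h.unique ha)
  refine ⟨S, LinearIsometryEquiv.ofSurjective Ψ Ψ_surj, fun g f => ?_⟩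
  change S.cls b (toMult (A.π g f)) = S.cls b (S.transMult b g (toMult f))
  rw [InnerSystem.cls_eq_cls]
  -- Both functions agree at `x` as soon as `g⁻¹` preserves the last letter of `x` and maps its cone
  -- onto the cone of `g⁻¹ * x`.
  refine ((finite_getLast_mul_ne b g⁻¹).union (finite_cone_translate b g⁻¹)).subset fun x hx => ?_
  simp only [Set.mem_union, Set.mem_ofPred_eq]
  by_contra! h
  apply hx
  change F (A.π g f) x - F f (g⁻¹ * x) = 0
  rw [sub_eq_zero]
  funext c
  simp only [F, EndsWith, h.1, A.loc_translate h.2 f]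

end LocalFamily

end BoundaryAction

theorem finiteDimensional_map_of_ker_le {K M N F : Type*} [Field K] [AddCommGroup M] [Module K M]
    [AddCommGroup N] [Module K N] [AddCommGroup F] [Module K F] [FiniteDimensional K F]
    (p : Submodule K M) (φ : p →ₗ[K] F) (ψ : M →ₗ[K] N) (h : ∀ v : p, φ v = 0 → ψ v = 0) :
    FiniteDimensional K (p.map ψ) := by
  have hker : LinearMap.ker φ ≤ LinearMap.ker (ψ ∘ₗ p.subtype) := fun v hv => h v hv
  have : FiniteDimensional K (p ⧸ LinearMap.ker φ) :=
    φ.quotKerEquivRange.symm.finiteDimensional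
  have h : p.map ψ = LinearMap.range ((LinearMap.ker φ).liftQ _ hker) := by
    rw [Submodule.range_liftQ, LinearMap.range_comp, Submodule.range_subtype]
  rw [h]
  infer_instance

/-! ### The boundary action on multiplicative functions. -/

namespace InnerSystem

variable {Γ : Type u} [Group Γ] {κ : Type v} [Fintype κ] [DecidableEq κ]
variable (S : InnerSystem κ) (b : FreeGroupBasis κ Γ)

/-- The multiplicativity condition at the single element `x`. -/
def MultAt (f : Γ → ∀ a, S.V a) (x : Γ) : Prop :=
  ∀ a, EndsWith b x a →
    (∀ c, c ≠ a → f x c = 0) ∧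
    ∀ c, len b (x * letter b c) = len b x + 1 →
      f (x * letter b c) = Pi.single c (S.H c a (f x a))

variable {S b}

theorem MultAt.zero (x : Γ) : S.MultAt b 0 x := fun _ _ => ⟨fun _ _ => rfl, fun c _ => by simp⟩

theorem MultAt.add {f g : Γ → ∀ a, S.V a} {x : Γ} (hf : S.MultAt b f x) (hg : S.MultAt b g x) :
    S.MultAt b (f + g) x := by
  intro a ha
  have h1 := hf a ha
  have h2 := hg a ha
  refine ⟨fun c hc => ?_, fun c hc => ?_⟩
  · simp [h1.1 c hc, h2.1 c hc]
  · simp [h1.2 c hc, h2.2 c hc, Pi.single_add]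

theorem MultAt.smul {f : Γ → ∀ a, S.V a} {x : Γ} (r : ℂ) (hf : S.MultAt b f x) :
    S.MultAt b (r • f) x := by
  intro a ha
  have h1 := hf a ha
  refine ⟨fun c hc => ?_, fun c hc => ?_⟩
  · simp [h1.1 c hc]
  · simp [h1.2 c hc, Pi.single_smul]

/-- The condition at `x` involves only `x` and its right neighbours, so a cut-off is harmless where
all of them lie on the same side of `C`. -/
theorem MultAt.indicator {f : Γ → ∀ a, S.V a} {x : Γ} {C : Set Γ} (hf : x ∈ C → S.MultAt b f x)
    (hC : ∀ c, x ∈ C ↔ x * letter b c ∈ C) : S.MultAt b (C.indicator f) x := by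
  intro a ha
  by_cases hx : x ∈ C
  · refine ⟨fun c hc => ?_, fun c hc => ?_⟩
    · rw [Set.indicator_of_mem hx, (hf hx a ha).1 c hc]
    · rw [Set.indicator_of_mem hx, Set.indicator_of_mem ((hC c).mp hx), (hf hx a ha).2 c hc]
  · refine ⟨fun c _ => ?_, fun c _ => ?_⟩
    · rw [Set.indicator_of_notMem hx, Pi.zero_apply]
    · rw [Set.indicator_of_notMem hx, Set.indicator_of_notMem fun h => hx ((hC c).mpr h)]
      simp

theorem MultAt.translate {f : Γ → ∀ a, S.V a} {x y : Γ}
    (h : (word b (x * y)).getLast? = (word b y).getLast?) (hf : S.MultAt b f (x * y)) :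
    S.MultAt b (fun z => f (x * z)) y := by
  intro a ha
  have h1 := hf a (h.trans ha)
  refine ⟨h1.1, fun c hc => ?_⟩
  change f (x * (y * letter b c)) = _
  rw [← mul_assoc]
  refine h1.2 c ?_
  rw [len_mul_letter_iff] at hc ⊢
  exact fun h' => hc (h.symm.trans h')

/-- The radius depends on the exceptional set alone and not on `f`; finite dimension rests on this
uniformity. -/
theorem exists_isMultFrom {Z : Set Γ} (hZ : Z.Finite) :
    ∃ N, ∀ f, (∀ x, x ∉ Z → S.MultAt b f x) → S.IsMultFrom b N f := by
  obtain ⟨N, hN⟩ := (hZ.image (len b)).bddAbove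
  refine ⟨N + 1, fun f hf x hx => hf x fun h => ?_⟩
  have : len b x ≤ N := hN ⟨x, h, rfl⟩
  omega

theorem indicator_mem_mult {C : Set Γ} (hC : AlmostInvariant C) {f : Γ → ∀ a, S.V a}
    (hf : f ∈ S.mult b) : C.indicator f ∈ S.mult b := by
  obtain ⟨N, hN⟩ := hf
  obtain ⟨M, hM⟩ := exists_isMultFrom (S := S) (b := b) ((finite_len_le b N).union
    (Set.finite_iUnion fun c : Letter κ => hC (letter b c)))
  refine ⟨M, hM _ fun x hx => ?_⟩
  simp only [Set.mem_union, Set.mem_ofPred_eq, Set.mem_iUnion, not_or, not_le, not_exists,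
    not_not] at hx
  exact MultAt.indicator (fun _ => hN x hx.1.le) hx.2

variable (S b)

open Classical in
/-- Restriction of multiplicative functions to an almost invariant set. -/
noncomputable def resMult (C : Set Γ) : S.mult b →ₗ[ℂ] S.mult b where
  -- Zero is a default value that makes the map total in `C`.
  toFun f := if hC : AlmostInvariant C then ⟨C.indicator f.1, indicator_mem_mult hC f.2⟩ else 0
  map_add' f g := by
    split_ifs
    · exact Subtype.ext (Set.indicator_add C f.1 g.1)
    · simp
  map_smul' r f := by
    split_ifs
    · exact Subtype.ext (Set.indicator_const_smul C r f.1)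
    · simp

theorem resMult_apply {C : Set Γ} (hC : AlmostInvariant C) (f : S.mult b) :
    (S.resMult b C f).1 = C.indicator f.1 :=
  congrArg Subtype.val (dif_pos hC)

/-- Restriction to an almost invariant set, on `ℋ^∞`. -/
noncomputable def res (C : Set Γ) : S.Hinf b →ₗ[ℂ] S.Hinf b :=
  (S.null b).mapQ (S.null b) (S.resMult b C) fun f hf => by
    have h : {x | f.1 x ≠ 0}.Finite := hf
    by_cases hC : AlmostInvariant C
    · refine h.subset fun x hx hfx => hx ?_
      rw [resMult_apply S b hC, Set.indicator_apply_eq_zero.mpr fun _ => hfx]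
    · have h0 : S.resMult b C f = 0 := dif_neg hC
      rw [Submodule.mem_comap, h0]
      exact zero_mem _

theorem res_cls (C : Set Γ) (f : S.mult b) : S.res b C (S.cls b f) = S.cls b (S.resMult b C f) :=
  rfl

theorem trans_cls (g : Γ) (f : S.mult b) :
    S.trans b g (S.cls b f) = S.cls b (S.transMult b g f) := rfl

theorem inner_cls (f g : S.mult b) : inner ℂ (S.cls b f) (S.cls b g) = S.form b f g :=
  S.formInf_cls b f g

/-- The form pairs the two functions point by point, so an indicator may stand on either side. -/
theorem form_resMult {C : Set Γ} (hC : AlmostInvariant C) (f g : S.mult b) :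
    S.form b (S.resMult b C f) g = S.form b f (S.resMult b C g) := by
  obtain ⟨N, hN⟩ := S.form_eventually b (S.resMult b C f) g
  obtain ⟨M, hM⟩ := S.form_eventually b f (S.resMult b C g)
  rw [hN (N + M) (by omega), hM (N + M) (by omega), resMult_apply S b hC, resMult_apply S b hC,
    sphereForm, sphereForm]
  refine Finset.sum_congr rfl fun x _ => Finset.sum_congr rfl fun a _ => ?_
  by_cases h : x * letter b a ∈ C
  · rw [Set.indicator_of_mem h, Set.indicator_of_mem h]
  · rw [Set.indicator_of_notMem h, Set.indicator_of_notMem h]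
    simp

/-- Translations and restrictions on the space of multiplicative functions. -/
noncomputable def boundaryAction (h : ∀ g f, ‖S.trans b g f‖ = ‖f‖) :
    BoundaryAction Γ (S.Hinf b) where
  π := S.trans b
  π_one f := by
    obtain ⟨f, rfl⟩ := S.cls_surjective b f
    rw [trans_cls]
    congr 1
    ext y : 2
    change f.1 (1⁻¹ * y) = _
    rw [inv_one, one_mul]
  π_mul g g' f := by
    obtain ⟨f, rfl⟩ := S.cls_surjective b f
    rw [trans_cls, trans_cls, trans_cls]
    congr 1
    ext y : 2
    change f.1 ((g * g')⁻¹ * y) = f.1 (g'⁻¹ * (g⁻¹ * y))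
    rw [mul_inv_rev, mul_assoc]
  inner_π g f f' := (LinearIsometry.mk (S.trans b g) (h g)).inner_map_map f f'
  P := S.res b
  P_empty f := by
    obtain ⟨f, rfl⟩ := S.cls_surjective b f
    have h0 : AlmostInvariant (∅ : Set Γ) := fun s => by simp
    rw [res_cls, ← map_zero (S.cls b)]
    congr 1
    apply Subtype.ext
    rw [resMult_apply S b h0, Set.indicator_empty]
    rfl
  P_inter hC hD f := by
    obtain ⟨f, rfl⟩ := S.cls_surjective b f
    rw [res_cls, res_cls, res_cls]
    congr 1
    apply Subtype.ext
    rw [resMult_apply S b hC, resMult_apply S b hD, resMult_apply S b (hC.inter hD),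
      Set.indicator_indicator]
  P_symm hC f f' := by
    obtain ⟨f, rfl⟩ := S.cls_surjective b f
    obtain ⟨f', rfl⟩ := S.cls_surjective b f'
    rw [res_cls, res_cls, inner_cls, inner_cls, form_resMult S b hC]
  P_partition s C hC hfin f := by
    obtain ⟨f, rfl⟩ := S.cls_surjective b f
    simp only [res_cls]
    rw [← map_sum, cls_eq_cls]
    refine hfin.subset fun y hy => ?_
    contrapose! hy
    simp only [Set.mem_ofPred_eq, not_not] at hy
    obtain ⟨x, ⟨hxs, hxy⟩, hx⟩ := hy
    simp only [Set.mem_ofPred_eq, not_not]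
    change (∑ x ∈ s, S.resMult b (C x) f).1 y - f.1 y = 0
    rw [sub_eq_zero, AddSubmonoidClass.coe_finsetSum, Finset.sum_apply, Finset.sum_eq_single x]
    · rw [resMult_apply S b (hC x hxs), Set.indicator_of_mem hxy]
    · intro z hz hzx
      rw [resMult_apply S b (hC z hz), Set.indicator_of_notMem fun h => hzx (hx z ⟨hz, h⟩)]
    · exact fun h => absurd hxs h
  π_P g C hC f := by
    obtain ⟨f, rfl⟩ := S.cls_surjective b f
    rw [res_cls, trans_cls, trans_cls, res_cls]
    congr 1
    apply Subtype.ext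
    rw [resMult_apply S b (hC.translate g)]
    funext y
    change (S.resMult b C f).1 (g⁻¹⁻¹ * y) = _
    rw [resMult_apply S b hC, inv_inv]
    by_cases hy : g * y ∈ C
    · rw [Set.indicator_of_mem hy,
        Set.indicator_of_mem (show y ∈ (fun y => g * y) ⁻¹' C from hy)]
      change _ = f.1 (g⁻¹⁻¹ * y)
      rw [inv_inv]
    · rw [Set.indicator_of_notMem hy,
        Set.indicator_of_notMem (show y ∉ (fun y => g * y) ⁻¹' C from hy)]

/-- The functions that are multiplicative from radius `N` on. -/
def multFrom (N : ℕ) : Submodule ℂ (S.mult b) where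
  carrier := {f | S.IsMultFrom b N f.1}
  zero_mem' := fun x _ => MultAt.zero x
  add_mem' := fun hf hg x hx => MultAt.add (hf x hx) (hg x hx)
  smul_mem' := fun r _ hf x hx => MultAt.smul r (hf x hx)

variable {S b} in
-- The recursion propagates zeros outwards. It starts at `N + 1` because for `N = 0` the identity
-- has no last letter and determines nothing.
theorem IsMultFrom.eq_zero {N : ℕ} {f : Γ → ∀ a, S.V a} (hf : S.IsMultFrom b N f)
    (h0 : ∀ x, len b x = N + 1 → f x = 0) {x : Γ} (hx : N + 1 ≤ len b x) : f x = 0 := by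
  generalize hn : len b x = n at hx
  induction n, hx using Nat.le_induction generalizing x with
  | base => exact h0 x hn
  | succ n hn' ih =>
    obtain ⟨c, hc⟩ := exists_endsWith b (x := x) (by omega)
    have hE : EndsWith b x c.inv.inv := by rwa [Letter.inv_inv]
    have h1 := congrArg List.length (word_mul_letter_of_endsWith b hE)
    simp only [List.length_append, List.length_singleton] at h1
    have hlen : len b (x * letter b c.inv) = n := by
      simp only [len] at hn ⊢
      omega
    obtain ⟨a, ha⟩ := exists_endsWith b (x := x * letter b c.inv) (by omega)
    have h2 := (hf _ (by omega) a ha).2 c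
    rw [letter_inv, inv_mul_cancel_right, ← letter_inv] at h2
    rw [h2 (by omega), ih hlen]
    simp

theorem finiteDimensional_map_multFrom (N : ℕ) :
    FiniteDimensional ℂ ((S.multFrom b N).map (S.cls b)) := by
  let φ : S.multFrom b N →ₗ[ℂ] (sphere b (N + 1) → ∀ a, S.V a) :=
    { toFun := fun f x => f.1.1 x
      map_add' := fun _ _ => rfl
      map_smul' := fun _ _ => rfl }
  refine finiteDimensional_map_of_ker_le (S.multFrom b N) φ (S.cls b) fun f hf => ?_
  rw [← map_zero (S.cls b), cls_eq_cls, sub_zero]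
  refine (finite_len_le b N).subset fun x hx => ?_
  by_contra hlen
  simp only [Set.mem_ofPred_eq, not_le] at hlen
  exact hx (IsMultFrom.eq_zero f.2 (fun y hy => congrFun hf ⟨y, (mem_sphere b).mpr hy⟩) hlen)

/-! ### The local family of another basis. -/

variable {ι : Type w} [Fintype ι] [DecidableEq ι] (b' : FreeGroupBasis ι Γ)

/-- Restrictions of multiplicative functions to cones of another basis, translated back, are
multiplicative from a fixed radius on. -/
theorem exists_isMultFrom_translate_indicator : ∃ N, ∀ x a, EndsWith b' x a →
    ∀ f, (∀ y ∈ cone b' x, S.MultAt b f y) →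
      S.IsMultFrom b N fun y => (cone b' x).indicator f (x * y) := by
  obtain ⟨K, hK⟩ := exists_getLast_mul_eq b' b
  -- The exceptional set does not involve `x`: it consists of a ball and of the places where some
  -- letter changes membership in one of the finitely many sets `follow b' a`.
  obtain ⟨N, hN⟩ := exists_isMultFrom (S := S) (b := b) ((finite_len_le b' K).union
    (Set.finite_iUnion fun a : Letter ι => Set.finite_iUnion fun c : Letter κ =>
      almostInvariant_follow (b := b') a (letter b c)))
  refine ⟨N, fun x a ha f hf => hN _ fun y hy => ?_⟩
  simp only [Set.mem_union, Set.mem_ofPred_eq, Set.mem_iUnion, not_or, not_le, not_exists,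
    not_not] at hy
  have h : (fun y => (cone b' x).indicator f (x * y))
      = (follow b' a).indicator fun y => f (x * y) := by
    classical
    funext y
    simp only [Set.indicator_apply, mul_mem_cone_iff_mem_follow ha]
  rw [h]
  refine MultAt.indicator (fun hya => ?_) (hy.2 a)
  rw [← mul_mem_cone_iff_mem_follow ha] at hya
  exact MultAt.translate (hK x y hy.1 hya) (hf _ hya)

/-- The local family of another basis: it is spanned by all restrictions to cones of the functions
that are multiplicative on the whole cone, translated back. -/
noncomputable def localFamily (h : ∀ g f, ‖S.trans b g f‖ = ‖f‖) :
    (S.boundaryAction b h).LocalFamily b' where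
  W a := Submodule.span ℂ {v | ∃ x f, EndsWith b' x a ∧ (∀ y ∈ cone b' x, S.MultAt b f.1 y) ∧
    (S.boundaryAction b h).loc b' x (S.cls b f) = v}
  finiteDimensional a := by
    obtain ⟨N, hN⟩ := S.exists_isMultFrom_translate_indicator b b'
    have := S.finiteDimensional_map_multFrom b N
    refine Submodule.finiteDimensional_of_le (S₂ := (S.multFrom b N).map (S.cls b))
      (Submodule.span_le.mpr ?_)
    rintro _ ⟨x, f, hx, hf, rfl⟩
    refine ⟨S.transMult b x⁻¹ (S.resMult b (cone b' x) f), ?_, rfl⟩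
    have h1 : (S.transMult b x⁻¹ (S.resMult b (cone b' x) f)).1
        = fun y => (cone b' x).indicator f.1 (x * y) := by
      funext y
      change (S.resMult b (cone b' x) f).1 (x⁻¹⁻¹ * y) = _
      rw [resMult_apply S b (almostInvariant_cone x), inv_inv]
    change S.IsMultFrom b N (S.transMult b x⁻¹ (S.resMult b (cone b' x) f)).1
    rw [h1]
    exact hN x a hx f.1 hf
  P_follow {a v} hv := by
    induction hv using Submodule.span_induction with
    | mem v hv =>
      obtain ⟨x, f, hx, -, rfl⟩ := hv
      exact BoundaryAction.P_follow_loc _ hx _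
    | zero => rw [map_zero]
    | add v w _ _ hv hw => rw [map_add, hv, hw]
    | smul r v _ hv => rw [map_smul, hv]
  loc_mem {a c v} hv hc := by
    induction hv using Submodule.span_induction with
    | mem v hv =>
      obtain ⟨x, f, hx, hf, rfl⟩ := hv
      have hl : len b' (x * letter b' c) = len b' x + 1 := by
        rw [len_mul_letter_iff]
        intro hE
        exact hc (by rw [hx.unique hE, Letter.inv_inv])
      rw [BoundaryAction.loc_letter_loc _ hl]
      exact Submodule.subset_span ⟨_, f, endsWith_mul_letter b' hl,
        fun y hy => hf y (cone_mul_letter_subset hl hy), rfl⟩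
    | zero =>
      rw [map_zero]
      exact zero_mem _
    | add v w _ _ hv hw =>
      rw [map_add]
      exact add_mem hv hw
    | smul r v _ hv =>
      rw [map_smul]
      exact Submodule.smul_mem _ r hv
  eventually_mem f := by
    obtain ⟨f, rfl⟩ := S.cls_surjective b f
    obtain ⟨N, hN⟩ := f.2
    -- The ball where `f` may fail to be multiplicative has bounded length in the basis `b'`, so
    -- cones far enough out avoid it.
    obtain ⟨M, hM⟩ := ((finite_len_le b N).image (len b')).bddAbove
    refine ⟨M + 1, fun x a hx ha => Submodule.subset_span ⟨x, f, ha, fun y hy => hN y ?_, rfl⟩⟩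
    by_contra hlt
    have h1 : len b' y ≤ M := hM ⟨y, (not_le.mp hlt).le, rfl⟩
    have h2 := len_le_of_mem_cone hy
    omega

end InnerSystem

/-! ### Extension of isometries to completions. -/

section Completion

open UniformSpace

theorem exists_completion_equiv {E F : Type*} [NormedAddCommGroup E] [InnerProductSpace ℂ E]
    [NormedAddCommGroup F] [InnerProductSpace ℂ F] (Φ : E ≃ₗᵢ[ℂ] F) :
    ∃ Ψ : Completion E ≃ₗᵢ[ℂ] Completion F, ∀ f : E, Ψ f = Φ f := by
  let T : Completion E →L[ℂ] Completion F :=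
    (Φ.toContinuousLinearEquiv : E →L[ℂ] F).completion
  let T' : Completion F →L[ℂ] Completion E :=
    (Φ.symm.toContinuousLinearEquiv : F →L[ℂ] E).completion
  have hT : ∀ f : E, T f = Φ f := fun f => ContinuousLinearMap.completion_apply_coe _ f
  have hT' : ∀ f : F, T' f = Φ.symm f := fun f => ContinuousLinearMap.completion_apply_coe _ f
  have h1 : ∀ x, T (T' x) = x := fun x => Completion.induction_on x
    (isClosed_eq (T.continuous.comp T'.continuous) continuous_id) fun f => by
      rw [hT', hT, Φ.apply_symm_apply]
  have h2 : ∀ x, T' (T x) = x := fun x => Completion.induction_on x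
    (isClosed_eq (T'.continuous.comp T.continuous) continuous_id) fun f => by
      rw [hT, hT', Φ.symm_apply_apply]
  have h3 : ∀ x, ‖T x‖ = ‖x‖ := fun x => Completion.induction_on x
    (isClosed_eq T.continuous.norm continuous_norm) fun f => by
      rw [hT, Completion.norm_coe, Completion.norm_coe, Φ.norm_map]
  exact ⟨{ toLinearEquiv := LinearEquiv.ofLinearMap T.toLinearMap T'.toLinearMap
            (LinearMap.ext h1) (LinearMap.ext h2)
           norm_map' := h3 }, hT⟩

end Completion

/-! ### Composition with an automorphism. -/

section Automorphism

variable {Γ : Type u} [Group Γ] {ι : Type v} [DecidableEq ι] (b : FreeGroupBasis ι Γ)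
  (φ : MulAut Γ)

theorem word_map (x : Γ) : word (b.map φ.symm) x = word b (φ x) := rfl

theorem len_map (x : Γ) : len (b.map φ.symm) x = len b (φ x) := rfl

omit [DecidableEq ι] in
theorem apply_letter_map (a : Letter ι) : φ (letter (b.map φ.symm) a) = letter b a := by
  obtain ⟨i, s⟩ := a
  cases s <;> simp [letter]

namespace InnerSystem

variable [Fintype ι] (S : InnerSystem ι)

/-- The word of `x` in the basis `b.map φ.symm` is the word of `φ x` in `b`, so `φ` carries one
condition to the other. -/
theorem isMultFrom_comp_iff (N : ℕ) (f : Γ → ∀ a, S.V a) :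
    S.IsMultFrom (b.map φ.symm) N (fun x => f (φ x)) ↔ S.IsMultFrom b N f := by
  unfold IsMultFrom
  conv_rhs => rw [φ.surjective.forall]
  simp only [EndsWith, word_map, len_map, map_mul, apply_letter_map]

/-- Composition with an automorphism, on multiplicative functions. -/
def compMult : S.mult b →ₗ[ℂ] S.mult (b.map φ.symm) where
  toFun f := ⟨fun x => f.1 (φ x), f.2.imp fun N hN => (S.isMultFrom_comp_iff b φ N f.1).mpr hN⟩
  map_add' _ _ := rfl
  map_smul' _ _ := rfl

theorem sphereForm_comp (N : ℕ) (f g : Γ → ∀ a, S.V a) :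
    S.sphereForm (b.map φ.symm) N (fun x => f (φ x)) (fun x => g (φ x))
      = S.sphereForm b N f g := by
  refine Finset.sum_equiv φ.toEquiv (fun x => ?_) fun x _ => ?_
  · rw [mem_sphere, mem_sphere]
    rfl
  · change _ = ∑ a : Letter ι, if len b (φ x * letter b a) = len b (φ x) + 1 then
      S.B a (f (φ x * letter b a) a) (g (φ x * letter b a) a) else 0
    simp only [len_map, map_mul, apply_letter_map]

theorem form_compMult (f g : S.mult b) :
    S.form (b.map φ.symm) (S.compMult b φ f) (S.compMult b φ g) = S.form b f g := by
  obtain ⟨N, hN⟩ := S.form_eventually (b.map φ.symm) (S.compMult b φ f) (S.compMult b φ g)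
  obtain ⟨M, hM⟩ := S.form_eventually b f g
  rw [hN (N + M) (by omega), hM (N + M) (by omega), ← S.sphereForm_comp b φ]
  rfl

theorem exists_equiv_comp : ∃ Φ : S.Hinf b ≃ₗᵢ[ℂ] S.Hinf (b.map φ.symm),
    ∀ x f, Φ (S.trans b (φ x) f) = S.trans (b.map φ.symm) x (Φ f) := by
  let Φ₀ : S.Hinf b →ₗ[ℂ] S.Hinf (b.map φ.symm) :=
    (S.null b).mapQ (S.null (b.map φ.symm)) (S.compMult b φ) fun f hf => by
      have h : {x | f.1 x ≠ 0}.Finite := hf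
      exact h.preimage φ.injective.injOn
  have h₀ : ∀ f, Φ₀ (S.cls b f) = S.cls _ (S.compMult b φ f) := fun _ => rfl
  let Φ : S.Hinf b →ₗᵢ[ℂ] S.Hinf (b.map φ.symm) := Φ₀.isometryOfInner fun p q => by
    obtain ⟨f, rfl⟩ := S.cls_surjective b p
    obtain ⟨g, rfl⟩ := S.cls_surjective b q
    rw [h₀, h₀, inner_cls, inner_cls, form_compMult]
  have hsurj : Function.Surjective Φ := by
    intro p
    obtain ⟨⟨g, N, hN⟩, rfl⟩ := S.cls_surjective _ p
    have hg : (fun x => (fun y => g (φ.symm y)) (φ x)) = g := by simp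
    refine ⟨S.cls b ⟨fun y => g (φ.symm y), N, ?_⟩, ?_⟩
    · rw [← S.isMultFrom_comp_iff b φ, hg]
      exact hN
    · exact congrArg _ (Subtype.ext hg)
  refine ⟨LinearIsometryEquiv.ofSurjective Φ hsurj, fun x p => ?_⟩
  obtain ⟨f, rfl⟩ := S.cls_surjective b p
  refine congrArg (S.cls _) (Subtype.ext (funext fun y => ?_))
  change f.1 ((φ x)⁻¹ * φ y) = f.1 (φ (x⁻¹ * y))
  rw [map_mul, map_inv]

end InnerSystem

end Automorphism

/-! ### Change of basis and automorphism invariance for representations. -/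

section Representations

variable {Γ : Type u} [Group Γ] {ι κ : Type*} [Fintype ι] [DecidableEq ι] [Fintype κ]
  [DecidableEq κ] {H : Type*} [NormedAddCommGroup H] [InnerProductSpace ℂ H] [CompleteSpace H]

/-- A representation realized by multiplicative functions of a system `S` can be realized by those
of a system `S'` when the spaces of multiplicative functions are equivariantly isometric. -/
theorem inMult_of_equiv {b : FreeGroupBasis ι Γ} {b' : FreeGroupBasis κ Γ}
    {ρ : Γ →* unitary (H →L[ℂ] H)} {S : InnerSystem ι} {S' : InnerSystem κ} {M : Submodule ℂ H}
    {U : H ≃ₗᵢ[ℂ] S.Hilb b} (hM : Dense (M : Set H))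
    (hUM : U '' (M : Set H) = Set.range ((↑) : S.Hinf b → S.Hilb b))
    (hU : ∀ x, ∀ m ∈ M, ∀ f : S.Hinf b, U m = (f : S.Hilb b) →
      U ((ρ x : H →L[ℂ] H) m) = (S.trans b x f : S.Hilb b))
    (σ : Γ →* Γ) (Φ : S.Hinf b ≃ₗᵢ[ℂ] S'.Hinf b')
    (hΦ : ∀ x f, Φ (S.trans b (σ x) f) = S'.trans b' x (Φ f)) : InMult b' (ρ.comp σ) := by
  obtain ⟨Ψ, hΨ⟩ := exists_completion_equiv Φ
  refine ⟨S', M, U.trans Ψ, hM, ?_, fun x m hm f hf => ?_⟩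
  · rw [LinearIsometryEquiv.coe_trans, Set.image_comp, hUM, ← Set.range_comp,
      show (Ψ ∘ ((↑) : S.Hinf b → S.Hilb b)) = ((↑) : S'.Hinf b' → S'.Hilb b') ∘ Φ from funext hΨ,
      Φ.surjective.range_comp]
  · have h1 : U m = ((Φ.symm f : S.Hinf b) : S.Hilb b) := by
      apply Ψ.injective
      rw [hΨ, Φ.apply_symm_apply]
      exact hf
    change Ψ (U ((ρ (σ x) : H →L[ℂ] H) m)) = _
    rw [hU (σ x) m hm _ h1, hΨ, hΦ, Φ.apply_symm_apply]

theorem InMult.change_basis {b : FreeGroupBasis ι Γ} {ρ : Γ →* unitary (H →L[ℂ] H)}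
    (h : InMult b ρ) (b' : FreeGroupBasis κ Γ) : InMult b' ρ := by
  obtain ⟨S, M, U, hM, hUM, hU⟩ := h
  -- That left translations are isometric on `ℋ^∞` is inherited from the unitarity of `ρ` through
  -- `U`.
  have hnorm : ∀ g f, ‖S.trans b g f‖ = ‖f‖ := by
    intro g f
    obtain ⟨m, hm, hmf⟩ : (f : S.Hilb b) ∈ U '' (M : Set H) := hUM ▸ Set.mem_range_self f
    rw [← UniformSpace.Completion.norm_coe, ← UniformSpace.Completion.norm_coe f, ← hmf,
      ← hU g m hm f hmf, U.norm_map, U.norm_map, Unitary.norm_map]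
  obtain ⟨S', Φ, hΦ⟩ := (S.localFamily b b' hnorm).exists_equiv
  exact inMult_of_equiv hM hUM hU (MonoidHom.id Γ) Φ hΦ

theorem InMult.comp_aut {b : FreeGroupBasis ι Γ} {ρ : Γ →* unitary (H →L[ℂ] H)}
    (h : InMult b ρ) (φ : MulAut Γ) : InMult b (ρ.comp φ.toMonoidHom) := by
  obtain ⟨S, M, U, hM, hUM, hU⟩ := h
  obtain ⟨Φ, hΦ⟩ := S.exists_equiv_comp b φ
  exact (inMult_of_equiv hM hUM hU φ.toMonoidHom Φ hΦ).change_basis b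

end Representations

end FreeMult

theorem mainTheorem2 {Γ : Type*} [Group Γ]
    {ι κ : Type*} [Fintype ι] [DecidableEq ι] [Fintype κ] [DecidableEq κ]
    (b : FreeGroupBasis ι Γ) (b' : FreeGroupBasis κ Γ)
    {H : Type*} [NormedAddCommGroup H] [InnerProductSpace ℂ H] [CompleteSpace H]
    (ρ : Γ →* unitary (H →L[ℂ] H)) :
    (FreeMult.InMult b' ρ → FreeMult.InMult b ρ) ∧
    (∀ φ : MulAut Γ, FreeMult.InMult b ρ → FreeMult.InMult b (ρ.comp φ.toMonoidHom)) ∧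
    (∀ φ : MulAut Γ, FreeMult.InMultGroup ρ → FreeMult.InMultGroup (ρ.comp φ.toMonoidHom)) :=
  ⟨fun h => h.change_basis b, fun φ h => h.comp_aut φ,
    fun φ ⟨n, c, h⟩ => ⟨n, c, h.comp_aut φ⟩⟩
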